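/- **Setting.** Let $P_{X,Y}$ be a primitive, i.e. a joint probability distribution on a product $\mathcal X\times\mathcal Y$ of finite sets. The dependent part of $X$ with respect to $Y$ is the random variable $X\searrow Y:=f_X(X)$, where $f_X(x):=P_{Y|X=x}$ for $P_X(x)>0$; symmetrically $Y\searrow X:=f_Y(Y)$ with $f_Y(y):=P_{X|Y=y}$. Let $P_{X\searrow Y,\,Y\searrow X}$ be the joint distribution of these two variables; it is again a primitive. $S$ denotes von Neumann entropy (in bits), $S(L;R)=S(L)+S(R)-S(LR)$ quantum mutual information, and $I(X;Y)$ Shannon mutual information. Let $A,B$ be registers with computational bases $\{|x\rangle\}_{x\in\mathcal X}$ and $\{|y\rangle\}_{y\in\mathcal Y}$, and let $A',B'$ be working registers of arbitrary finite dimension; Alice holds $AA'$ and Bob holds $BB'$. Write $X$ and $Y$ for the outcomes of measuring $A$ and $B$ in the computational basis. A pure state $|\psi\rangle\in\mathcal H_{AA'BB'}$ is an *embedding* of $P_{X,Y}$ if $(X,Y)$ has distribution $P_{X,Y}$ and $S(X;YB')=S(XA';Y)=I(X;Y)$. Its leakage is $$\Delta_\psi(P_{X,Y})=\max\{S(X;BB')-I(X;Y),\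 S(AA';Y)-I(X;Y)\}.$$ The leakage of the primitive is $\Delta_{P_{X,Y}}=\inf_\psi\Delta_\psi(P_{X,Y})$ over all embeddings $|\psi\rangle$ of $P_{X,Y}$. A *regular embedding* is a state $\sum_{x,y}e^{i\theta(x,y)}\sqrt{P_{X,Y}(x,y)}\,|x,y\rangle_{AB}$ with a real phase function $\theta$ and with empty (one-dimensional) $A',B'$; let $\Delta^{\mathrm{reg}}_{P_{X,Y}}$ be the infimum of the leakage over the regular embeddings of $P_{X,Y}$. **Theorem.** For every primitive $P_{X,Y}$, $$\Delta_{P_{X,Y}}\ \ge\ \Delta_{P_{X\searrow Y,\,Y\searrow X}},$$ and likewise $\Delta^{\mathrm{reg}}_{P_{X,Y}}\ge\Delta^{\mathrm{reg}}_{P_{X\searrow Y,\,Y\searrow X}}$. -/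

import Mathlib

noncomputable section

namespace QLeak

open scoped Classical

universe u v w

/-! ### Entropies (in bits) -/

/-- Shannon entropy `-∑ p log₂ p` of a finite distribution. -/
def shannon {ι : Type u} [Fintype ι] (p : ι → ℝ) : ℝ :=
  (∑ i, Real.negMulLog (p i)) / Real.log 2

/-- Von Neumann entropy: the Shannon entropy of the eigenvalues of a density matrix
(`0` by convention if the matrix is not Hermitian). -/
def vonNeumann {ι : Type u} [Fintype ι] (ρ : Matrix ι ι ℂ) : ℝ :=
  if h : ρ.IsHermitian then shannon h.eigenvalues else 0

/-- Partial trace over the second factor. -/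
def traceRight {l : Type u} {r : Type v} [Fintype r]
    (ρ : Matrix (l × r) (l × r) ℂ) : Matrix l l ℂ :=
  Matrix.of fun i j => ∑ k, ρ (i, k) (j, k)

/-- Partial trace over the first factor. -/
def traceLeft {l : Type u} {r : Type v} [Fintype l]
    (ρ : Matrix (l × r) (l × r) ℂ) : Matrix r r ℂ :=
  Matrix.of fun i j => ∑ k, ρ (k, i) (k, j)

/-- Quantum mutual information `S(L;R) = S(L) + S(R) - S(LR)` of a bipartite state. -/
def mutualInfo {l : Type u} {r : Type v} [Fintype l] [Fintype r]
    (ρ : Matrix (l × r) (l × r) ℂ) : ℝ :=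
  vonNeumann (traceRight ρ) + vonNeumann (traceLeft ρ) - vonNeumann ρ

/-! ### Primitives: joint distributions on finite alphabets -/

section Classical

variable {X : Type u} {Y : Type v} [Fintype X] [Fintype Y]

/-- The first marginal `P_X` of a joint distribution `P_{X,Y}`. -/
def margFst (P : X × Y → ℝ) (x : X) : ℝ := ∑ y, P (x, y)

/-- The second marginal `P_Y`. -/
def margSnd (P : X × Y → ℝ) (y : Y) : ℝ := ∑ x, P (x, y)

/-- Classical mutual information `I(X;Y) = H(X) + H(Y) - H(XY)`. -/
def classicalInfo (P : X × Y → ℝ) : ℝ :=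
  shannon (margFst P) + shannon (margSnd P) - shannon P

/-- The conditional distribution `P_{Y|X=x}` (meaningful when `P_X(x) > 0`). -/
def condFst (P : X × Y → ℝ) (x : X) : Y → ℝ := fun y => P (x, y) / margFst P x

/-- The conditional distribution `P_{X|Y=y}` (meaningful when `P_Y(y) > 0`). -/
def condSnd (P : X × Y → ℝ) (y : Y) : X → ℝ := fun x => P (x, y) / margSnd P y

/-- The alphabet of the dependent part `X ↘ Y`: the conditional distributions `P_{Y|X=x}`
with `P_X(x) > 0`. -/
def DepFst (P : X × Y → ℝ) : Type v :=
  {q : Y → ℝ // ∃ x, 0 < margFst P x ∧ condFst P x = q}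

/-- The alphabet of the dependent part `Y ↘ X`. -/
def DepSnd (P : X × Y → ℝ) : Type u :=
  {q : X → ℝ // ∃ y, 0 < margSnd P y ∧ condSnd P y = q}

instance instFintypeDepFst (P : X × Y → ℝ) : Fintype (DepFst P) :=
  (Set.Finite.subset (Set.finite_range (condFst P))
    (show {q | ∃ x, 0 < margFst P x ∧ condFst P x = q} ⊆ Set.range (condFst P) by
      rintro q ⟨x, -, rfl⟩; exact ⟨x, rfl⟩)).fintype

instance instFintypeDepSnd (P : X × Y → ℝ) : Fintype (DepSnd P) :=
  (Set.Finite.subset (Set.finite_range (condSnd P))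
    (show {q | ∃ y, 0 < margSnd P y ∧ condSnd P y = q} ⊆ Set.range (condSnd P) by
      rintro q ⟨y, -, rfl⟩; exact ⟨y, rfl⟩)).fintype

/-- The joint distribution of `(X ↘ Y, Y ↘ X) = (P_{Y|X=X}, P_{X|Y=Y})`. -/
def depPart (P : X × Y → ℝ) : DepFst P × DepSnd P → ℝ := fun z =>
  ∑ x, ∑ y, if condFst P x = z.1.1 ∧ condSnd P y = z.2.1 then P (x, y) else 0

/-- The pair of dependent parts is again a primitive. -/
theorem depPart_mem_stdSimplex {P : X × Y → ℝ} (hP : P ∈ stdSimplex ℝ (X × Y)) :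
    depPart P ∈ stdSimplex ℝ (DepFst P × DepSnd P) := by
  refine ⟨fun z => Finset.sum_nonneg fun x _ => Finset.sum_nonneg fun y _ => ?_, ?_⟩
  · split_ifs
    · exact hP.1 _
    · exact le_rfl
  · have key : ∀ x y, (∑ z : DepFst P × DepSnd P,
        if condFst P x = z.1.1 ∧ condSnd P y = z.2.1 then P (x, y) else 0) = P (x, y) := by
      intro x y
      rcases (hP.1 (x, y)).eq_or_lt with h0 | h0
      · simp [← h0]
      · have hx : 0 < margFst P x := lt_of_lt_of_le h0
          (Finset.single_le_sum (f := fun y => P (x, y)) (fun y _ => hP.1 _) (Finset.mem_univ y))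
        have hy : 0 < margSnd P y := lt_of_lt_of_le h0
          (Finset.single_le_sum (f := fun x => P (x, y)) (fun x _ => hP.1 _) (Finset.mem_univ x))
        rw [Finset.sum_eq_single
          ((⟨condFst P x, x, hx, rfl⟩, ⟨condSnd P y, y, hy, rfl⟩) : DepFst P × DepSnd P)]
        · simp
        · rintro ⟨⟨q, hq⟩, ⟨r, hr⟩⟩ - hne
          rw [if_neg]
          rintro ⟨rfl, rfl⟩
          exact hne rfl
        · simp
    unfold depPart
    rw [Finset.sum_comm]
    simp_rw [Finset.sum_comm (s := (Finset.univ : Finset (DepFst P × DepSnd P)))]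
    simp_rw [key]
    rw [← Fintype.sum_prod_type]
    exact hP.2

end Classical

/-! ### Embeddings and their leakage

The registers are `A` (indexed by `X`) with working register `A'`, held by Alice, and `B`
(indexed by `Y`) with working register `B'`, held by Bob. -/

section Quantum

variable {X : Type u} {Y : Type v} {A' B' : Type w}
  [Fintype X] [Fintype Y] [Fintype A'] [Fintype B']

/-- The density matrix `|ψ⟩⟨ψ|`. -/
def pureState {ι : Type u} (ψ : EuclideanSpace ℂ ι) : Matrix ι ι ℂ :=
  Matrix.of fun i j => ψ i * star (ψ j)

/-- The state after `A` is measured in the computational basis (outcome kept in `A`). -/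
def measureA {R : Type v} (ρ : Matrix ((X × A') × R) ((X × A') × R) ℂ) :
    Matrix ((X × A') × R) ((X × A') × R) ℂ :=
  Matrix.of fun i j => if i.1.1 = j.1.1 then ρ i j else 0

/-- The state after `B` is measured in the computational basis (outcome kept in `B`). -/
def measureB {L : Type u} (ρ : Matrix (L × (Y × B')) (L × (Y × B')) ℂ) :
    Matrix (L × (Y × B')) (L × (Y × B')) ℂ :=
  Matrix.of fun i j => if i.2.1 = j.2.1 then ρ i j else 0

/-- Partial trace over `A'`. -/
def discardA' {R : Type v} (ρ : Matrix ((X × A') × R) ((X × A') × R) ℂ) :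
    Matrix (X × R) (X × R) ℂ :=
  Matrix.of fun i j => ∑ a, ρ ((i.1, a), i.2) ((j.1, a), j.2)

/-- Partial trace over `B'`. -/
def discardB' {L : Type u} (ρ : Matrix (L × (Y × B')) (L × (Y × B')) ℂ) :
    Matrix (L × Y) (L × Y) ℂ :=
  Matrix.of fun i j => ∑ b, ρ (i.1, (i.2, b)) (j.1, (j.2, b))

/-- `S(X;BB')`: Alice's output `X` against Bob's unmeasured registers. -/
def infoX_BB' (ψ : EuclideanSpace ℂ ((X × A') × (Y × B'))) : ℝ :=
  mutualInfo (discardA' (measureA (pureState ψ)))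

/-- `S(AA';Y)`: Alice's unmeasured registers against Bob's output `Y`. -/
def infoAA'_Y (ψ : EuclideanSpace ℂ ((X × A') × (Y × B'))) : ℝ :=
  mutualInfo (discardB' (measureB (pureState ψ)))

/-- `S(X;YB')`: both `A` and `B` are measured. -/
def infoX_YB' (ψ : EuclideanSpace ℂ ((X × A') × (Y × B'))) : ℝ :=
  mutualInfo (discardA' (measureA (measureB (pureState ψ))))

/-- `S(XA';Y)`: both `A` and `B` are measured. -/
def infoXA'_Y (ψ : EuclideanSpace ℂ ((X × A') × (Y × B'))) : ℝ :=
  mutualInfo (discardB' (measureA (measureB (pureState ψ))))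

/-- `|ψ⟩` is an embedding of `P_{X,Y}`: measuring `A` and `B` in the computational basis yields
`P_{X,Y}`, and `S(X;YB') = S(XA';Y) = I(X;Y)`. -/
structure IsEmbedding (P : X × Y → ℝ) (ψ : EuclideanSpace ℂ ((X × A') × (Y × B'))) : Prop where
  outcome : ∀ x y, ∑ a, ∑ b, ‖ψ ((x, a), (y, b))‖ ^ 2 = P (x, y)
  infoB : infoX_YB' ψ = classicalInfo P
  infoA : infoXA'_Y ψ = classicalInfo P

/-- The leakage `Δ_ψ(P_{X,Y})`. -/
def leakage (P : X × Y → ℝ) (ψ : EuclideanSpace ℂ ((X × A') × (Y × B'))) : ℝ :=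
  max (infoX_BB' ψ - classicalInfo P) (infoAA'_Y ψ - classicalInfo P)

/-- The leakage `Δ_{P_{X,Y}}` of a primitive: the infimum of the leakage over all its embeddings,
with working registers of arbitrary finite dimensions. It is taken in the complete lattice `EReal`,
where it has no junk value. -/
def primitiveLeakage (P : X × Y → ℝ) : EReal :=
  ⨅ (a : ℕ) (b : ℕ) (ψ : EuclideanSpace ℂ ((X × Fin a) × (Y × Fin b))) (_ : IsEmbedding P ψ),
    ((leakage P ψ : ℝ) : EReal)

/-- The regular embedding `∑ e^{iθ(x,y)} √P(x,y) |x,y⟩` with phase function `θ`; the working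
registers are empty, that is, one-dimensional. -/
def regularEmbedding (P : X × Y → ℝ) (θ : X × Y → ℝ) :
    EuclideanSpace ℂ ((X × Fin 1) × (Y × Fin 1)) :=
  WithLp.toLp 2 fun i =>
    Complex.exp (Complex.I * (θ (i.1.1, i.2.1) : ℂ)) * (Real.sqrt (P (i.1.1, i.2.1)) : ℂ)

/-- The infimum of the leakage over the regular embeddings of a primitive. -/
def regularLeakage (P : X × Y → ℝ) : EReal :=
  ⨅ θ : X × Y → ℝ, ((leakage P (regularEmbedding P θ) : ℝ) : EReal)

end Quantum

end QLeak

end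

noncomputable section

namespace QLeak

open scoped Classical Matrix ComplexOrder

/-! ### Von Neumann entropy of Hermitian matrices -/

section Entropy

variable {ι κ μ : Type*} [Fintype ι] [Fintype κ] [Fintype μ]

/-! Let E be the entropy of entanglement of an unnormalized bipartite pure state, made homogeneous
of degree two, and let ψ_x, ψ_y, ψ_xy be the slices of ψ left by measuring `A`, `B` or both. Every
mutual information involved is a difference of such E's, up to I(X;Y): ψ is an embedding iff ∑
E(ψ_x) = ∑ E(ψ_xy) = ∑ E(ψ_y), and its leakage is then E(ψ) - ∑ E(ψ_xy) - I(X;Y) (`isEmbedding_iff`,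
`leakage_eq`).

Draw independently, for each value c of X↘Y, a representative g(c) with the law of X given X↘Y = c,
and likewise h(d) for Y↘X. Keep only the chosen rows and columns of ψ, divided by the square roots
of their conditional probabilities. Since P(x,y)/(P_X(x)P_Y(y)) depends only on the two dependent
parts, every such state has the outcome distribution of the dependent parts (`depPart_eq_div`), and
I is unchanged (`classicalInfo_depPart`).

The weights make the reduced state on the other side average to the original one, so concavity of
entropy (`homEntropy_superadditive`) shows that E(ψ), ∑ E(ψ_x) and ∑ E(ψ_y) do not increase on
average, while ∑ E(ψ_xy) keeps its average. The row and column sums always dominate the cell sum.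
Their equality for ψ therefore forces equality for every selection of positive probability: all of
these are embeddings, and one of them leaks no more than the average, hence no more than ψ
(`exists_selection`). A selection from a regular embedding is again regular. -/

theorem vonNeumann_eq_roots [DecidableEq ι] {ρ : Matrix ι ι ℂ} (h : ρ.IsHermitian) :
    vonNeumann ρ =
      (ρ.charpoly.roots.map fun z : ℂ => Real.negMulLog z.re).sum / Real.log 2 := by
  -- The eigenvalues in `vonNeumann` are formed with classical decidability, so the given instance
  -- is identified with it.
  cases Subsingleton.elim ‹DecidableEq ι› fun a b => Classical.propDecidable (a = b)
  rw [vonNeumann, dif_pos h, shannon, h.roots_charpoly_eq_eigenvalues, Multiset.map_map]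
  rfl

theorem vonNeumann_congr [DecidableEq ι] [DecidableEq κ] {ρ : Matrix ι ι ℂ} {σ : Matrix κ κ ℂ} (hρ : ρ.IsHermitian)
    (hσ : σ.IsHermitian) (h : ρ.charpoly = σ.charpoly) : vonNeumann ρ = vonNeumann σ := by
  rw [vonNeumann_eq_roots hρ, vonNeumann_eq_roots hσ, h]

theorem vonNeumann_transpose {ρ : Matrix ι ι ℂ} (h : ρ.IsHermitian) :
    vonNeumann ρᵀ = vonNeumann ρ :=
  vonNeumann_congr h.transpose h ρ.charpoly_transpose

/-- The two characteristic polynomials agree up to powers of the variable, and the extra zero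
eigenvalues contribute nothing because `Real.negMulLog 0 = 0`. -/
theorem vonNeumann_mul_conjTranspose_comm (N : Matrix ι κ ℂ) :
    vonNeumann (N * Nᴴ) = vonNeumann (Nᴴ * N) := by
  rw [vonNeumann_eq_roots (Matrix.isHermitian_mul_conjTranspose_self N),
    vonNeumann_eq_roots (Matrix.isHermitian_conjTranspose_mul_self N)]
  have h := congrArg Polynomial.roots (Matrix.charpoly_mul_comm' N Nᴴ)
  rw [Polynomial.roots_mul (mul_ne_zero (pow_ne_zero _ Polynomial.X_ne_zero)
      (Matrix.charpoly_monic _).ne_zero),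
    Polynomial.roots_mul (mul_ne_zero (pow_ne_zero _ Polynomial.X_ne_zero)
      (Matrix.charpoly_monic _).ne_zero), Polynomial.roots_X_pow, Polynomial.roots_X_pow] at h
  have h2 := congrArg (fun s => (Multiset.map (fun z : ℂ => Real.negMulLog z.re) s).sum) h
  simp [Multiset.map_nsmul, Multiset.sum_nsmul] at h2
  rw [h2]

theorem vonNeumann_diagonal (d : ι → ℝ) :
    vonNeumann (Matrix.diagonal fun i => (d i : ℂ)) = shannon d := by
  rw [vonNeumann_eq_roots (Matrix.isHermitian_diagonal_of_self_adjoint _ (by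
    ext i; simp)), Matrix.charpoly_diagonal, Polynomial.roots_prod _ _
      (Finset.prod_ne_zero_iff.2 fun i _ => Polynomial.X_sub_C_ne_zero _)]
  rw [Multiset.map_bind, Multiset.sum_bind, shannon]
  simp only [Polynomial.roots_X_sub_C, Multiset.map_singleton, Multiset.sum_singleton,
    Complex.ofReal_re]
  rfl

theorem charpoly_blockDiagonal [DecidableEq μ] [DecidableEq κ] (B : κ → Matrix μ μ ℂ) :
    (Matrix.blockDiagonal B).charpoly = ∏ k, (B k).charpoly := by
  have : (Matrix.blockDiagonal B).charmatrix = Matrix.blockDiagonal fun k => (B k).charmatrix := by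
    ext ⟨i, k⟩ ⟨j, l⟩
    by_cases hk : k = l <;> by_cases hi : i = j <;>
      simp [Matrix.blockDiagonal_apply, hk, hi]
  rw [Matrix.charpoly, this, Matrix.det_blockDiagonal]
  rfl

/-- The entropy of a block diagonal matrix is the sum of the entropies of its blocks. -/
theorem vonNeumann_block (e : ι ≃ μ × κ) (B : κ → Matrix μ μ ℂ) (hB : ∀ k, (B k).IsHermitian)
    {ρ : Matrix ι ι ℂ}
    (hρ : ∀ i j, ρ i j = if (e i).2 = (e j).2 then B (e i).2 (e i).1 (e j).1 else 0) :
    vonNeumann ρ = ∑ k, vonNeumann (B k) := by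
  have hρ' : ρ = Matrix.reindex e.symm e.symm (Matrix.blockDiagonal B) := by
    ext i j
    simp [hρ, Matrix.blockDiagonal_apply]
  have hH : (Matrix.blockDiagonal B).IsHermitian := by
    rw [Matrix.IsHermitian, Matrix.blockDiagonal_conjTranspose]
    simp_rw [(hB _).eq]
  rw [vonNeumann_congr (σ := Matrix.blockDiagonal B) (hρ' ▸ hH.submatrix _) hH
    (by rw [hρ', Matrix.charpoly_reindex]), vonNeumann_eq_roots hH, charpoly_blockDiagonal,
    Polynomial.roots_prod _ _
      (Finset.prod_ne_zero_iff.2 fun i _ => (Matrix.charpoly_monic _).ne_zero),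
    Multiset.map_bind, Multiset.sum_bind, Finset.sum_congr rfl fun k _ => vonNeumann_eq_roots (hB k),
    ← Finset.sum_div]
  rfl

/-! ### Concavity -/

omit [Fintype κ] in
theorem negMulLog_sum_le {s : Finset κ} (c q : κ → ℝ) (hc : ∀ i ∈ s, 0 ≤ c i)
    (hq : ∀ i ∈ s, 0 ≤ q i) (h1 : ∑ i ∈ s, c i = 1) :
    ∑ i ∈ s, c i * Real.negMulLog (q i) ≤ Real.negMulLog (∑ i ∈ s, c i * q i) := by
  simpa using Real.concaveOn_negMulLog.le_map_sum (t := s) (w := c) (p := q) hc h1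
    (fun i hi => hq i hi)

/-- The tangent of `negMulLog` at `b` lies above its graph. -/
theorem negMulLog_tangent {a b : ℝ} (ha : 0 ≤ a) (hb : 0 ≤ b) (h : b = 0 → a = 0) :
    Real.negMulLog a ≤ -a * Real.log b + (b - a) := by
  rcases ha.eq_or_lt with rfl | ha
  · simpa using hb
  · have hb : 0 < b := lt_of_le_of_ne hb fun h0 => ha.ne' (h h0.symm)
    have := Real.add_one_le_exp (Real.log b - Real.log a)
    rw [Real.exp_sub, Real.exp_log ha, Real.exp_log hb, le_div_iff₀ ha] at this
    rw [Real.negMulLog]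
    nlinarith

/-- The homogenized Shannon entropy is superadditive. -/
theorem sum_negMulLog_sub_superadditive (c : κ → ℝ) (hc : ∀ i, 0 ≤ c i) (p : κ → μ → ℝ)
    (hp : ∀ i k, 0 ≤ p i k) :
    ∑ i, c i * (∑ k, Real.negMulLog (p i k) - Real.negMulLog (∑ k, p i k)) ≤
      ∑ k, Real.negMulLog (∑ i, c i * p i k) - Real.negMulLog (∑ k, ∑ i, c i * p i k) := by
  set l : μ → ℝ := fun k => ∑ i, c i * p i k with hl
  set L : ℝ := ∑ k, l k with hL
  have hl0 : ∀ k, 0 ≤ l k := fun k => Finset.sum_nonneg fun i _ => mul_nonneg (hc i) (hp i k)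
  have hLs : ∑ i, c i * ∑ k, p i k = L := by
    simp only [hL, hl, Finset.mul_sum]
    exact Finset.sum_comm
  have key : ∀ i, c i * (∑ k, Real.negMulLog (p i k) - Real.negMulLog (∑ k, p i k)) ≤
      c i * (∑ k, -p i k * Real.log (l k) + (∑ k, p i k) * Real.log L) := by
    intro i
    rcases (hc i).eq_or_lt with h0 | h0
    · simp [← h0]
    refine mul_le_mul_of_nonneg_left ?_ h0.le
    set s : ℝ := ∑ k, p i k with hs
    have hs0 : 0 ≤ s := Finset.sum_nonneg fun k _ => hp i k
    rcases hs0.eq_or_lt with h1 | h1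
    · have : ∀ k, p i k = 0 := fun k =>
        (Finset.sum_eq_zero_iff_of_nonneg fun k _ => hp i k).1 (hs.symm.trans h1.symm) k
          (Finset.mem_univ k)
      simp [this, ← h1]
    have hL0 : 0 < L := by
      rw [← hLs]
      exact lt_of_lt_of_le (mul_pos h0 h1) (Finset.single_le_sum (f := fun i => c i * ∑ k, p i k)
        (fun i _ => mul_nonneg (hc i) (Finset.sum_nonneg fun k _ => hp i k)) (Finset.mem_univ i))
    -- The tangent is taken at `s / L * l k`, the mixture rescaled to the mass `s` of `p i`, so that
    -- the linear corrections sum to zero over `k`.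
    have hk : ∀ k, Real.negMulLog (p i k) ≤ -p i k * Real.log (l k) + p i k * Real.log L
        - p i k * Real.log s + (s / L * l k - p i k) := by
      intro k
      by_cases hlk : l k = 0
      · have : p i k = 0 := by
          have := (Finset.sum_eq_zero_iff_of_nonneg
            fun i _ => mul_nonneg (hc i) (hp i k)).1 hlk i (Finset.mem_univ i)
          exact (mul_eq_zero.1 this).resolve_left h0.ne'
        simp [this, hlk]
      have := negMulLog_tangent (hp i k) (mul_nonneg (div_nonneg hs0 hL0.le) (hl0 k))
        (fun h => absurd h (mul_ne_zero (div_ne_zero h1.ne' hL0.ne') hlk))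
      rw [Real.log_mul (div_ne_zero h1.ne' hL0.ne') hlk, Real.log_div h1.ne' hL0.ne'] at this
      linarith
    have := Finset.sum_le_sum fun k (_ : k ∈ Finset.univ) => hk k
    simp only [Finset.sum_add_distrib, Finset.sum_sub_distrib, ← Finset.sum_mul,
      ← Finset.mul_sum, ← hs, ← hL] at this
    rw [div_mul_cancel₀ _ hL0.ne'] at this
    have h2 : Real.negMulLog s = - s * Real.log s := rfl
    linarith
  refine (Finset.sum_le_sum fun i _ => key i).trans (le_of_eq ?_)
  simp only [mul_add, Finset.sum_add_distrib, Finset.mul_sum, ← mul_assoc]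
  rw [Finset.sum_comm]
  have h2 : Real.negMulLog L = - L * Real.log L := rfl
  have h3 : ∀ k, Real.negMulLog (l k) = ∑ i, c i * -p i k * Real.log (l k) := by
    intro k
    rw [← Finset.sum_mul, Real.negMulLog]
    simp [hl]
  rw [Finset.sum_congr rfl fun k _ => h3 k, h2, ← hLs]
  simp only [Finset.mul_sum, Finset.sum_mul, neg_mul, sub_neg_eq_add]

/-- Measuring a state in an orthonormal basis does not decrease its entropy. -/
theorem vonNeumann_le_shannon {ρ : Matrix ι ι ℂ} (hρ : ρ.PosSemidef)
    (U : Matrix.unitaryGroup ι ℂ) :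
    vonNeumann ρ ≤ shannon fun k => (star (U : Matrix ι ι ℂ) * ρ * (U : Matrix ι ι ℂ)) k k |>.re := by
  have hH := hρ.isHermitian
  rw [vonNeumann, dif_pos hH, shannon, shannon]
  refine div_le_div_of_nonneg_right ?_ (Real.log_nonneg (by norm_num))
  -- The squared moduli of `W` form a doubly stochastic matrix that takes the spectrum to the
  -- measured distribution. Column sums insert the weights, and row sums permit Jensen's inequality.
  set W : Matrix.unitaryGroup ι ℂ := star U * hH.eigenvectorUnitary with hW
  have hent : ∀ k, ((star (U : Matrix ι ι ℂ) * ρ * (U : Matrix ι ι ℂ)) k k).re =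
      ∑ j, ‖(W : Matrix ι ι ℂ) k j‖ ^ 2 * hH.eigenvalues j := by
    intro k
    have h1 : star (U : Matrix ι ι ℂ) * ρ * (U : Matrix ι ι ℂ) =
        (W : Matrix ι ι ℂ) * Matrix.diagonal (fun j => (hH.eigenvalues j : ℂ)) *
          star (W : Matrix ι ι ℂ) := by
      conv_lhs => rw [hH.spectral_theorem, Unitary.conjStarAlgAut_apply]
      simp only [hW, Submonoid.coe_mul, Unitary.coe_star, star_mul, star_star, Matrix.mul_assoc]
      rfl
    rw [h1, Matrix.mul_apply, Complex.re_sum]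
    refine Finset.sum_congr rfl fun j _ => ?_
    rw [Matrix.mul_diagonal, Matrix.star_apply, mul_right_comm, Complex.star_def,
      Complex.mul_conj, Complex.normSq_eq_norm_sq, ← Complex.ofReal_mul, Complex.ofReal_re]
  have hrow : ∀ k, ∑ j, ‖(W : Matrix ι ι ℂ) k j‖ ^ 2 = 1 := by
    intro k
    have := congrFun (congrFun (Matrix.mem_unitaryGroup_iff.1 W.2) k) k
    rw [Matrix.mul_apply, Matrix.one_apply_eq] at this
    simp only [Matrix.star_apply, Complex.star_def, Complex.mul_conj,
      Complex.normSq_eq_norm_sq] at this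
    exact_mod_cast this
  have hcol : ∀ j, ∑ k, ‖(W : Matrix ι ι ℂ) k j‖ ^ 2 = 1 := by
    intro k
    have := congrFun (congrFun (Matrix.mem_unitaryGroup_iff'.1 W.2) k) k
    rw [Matrix.mul_apply, Matrix.one_apply_eq] at this
    simp only [Matrix.star_apply, Complex.star_def, mul_comm _ ((W : Matrix ι ι ℂ) _ _),
      Complex.mul_conj, Complex.normSq_eq_norm_sq] at this
    exact_mod_cast this
  calc ∑ j, Real.negMulLog (hH.eigenvalues j)
      = ∑ j, (∑ k, ‖(W : Matrix ι ι ℂ) k j‖ ^ 2) * Real.negMulLog (hH.eigenvalues j) := by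
        simp [hcol]
    _ = ∑ k, ∑ j, ‖(W : Matrix ι ι ℂ) k j‖ ^ 2 * Real.negMulLog (hH.eigenvalues j) := by
        simp only [Finset.sum_mul]
        exact Finset.sum_comm
    _ ≤ _ := by
        refine Finset.sum_le_sum fun k _ => ?_
        rw [hent]
        exact negMulLog_sum_le _ _ (fun _ _ => by positivity)
          (fun j _ => hρ.eigenvalues_nonneg j) (hrow k)

/-- The entropy of an unnormalized state, made homogeneous of degree one. -/
def homEntropy (ρ : Matrix ι ι ℂ) : ℝ :=
  vonNeumann ρ - Real.negMulLog ρ.trace.re / Real.log 2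

/-- Measure everything in an eigenbasis of the mixture: its entropy is reproduced exactly, those of
the `σ i` can only grow, and all traces are kept. What remains is the classical inequality. -/
theorem homEntropy_superadditive (c : κ → ℝ) (hc : ∀ i, 0 ≤ c i) (σ : κ → Matrix ι ι ℂ)
    (hσ : ∀ i, (σ i).PosSemidef) :
    ∑ i, c i * homEntropy (σ i) ≤ homEntropy (∑ i, (c i : ℂ) • σ i) := by
  set ρ := ∑ i, (c i : ℂ) • σ i with hρ
  have hH : ρ.IsHermitian := by
    rw [Matrix.IsHermitian, hρ, Matrix.conjTranspose_sum]
    exact Finset.sum_congr rfl fun i _ => by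
      rw [Matrix.conjTranspose_smul, (hσ i).isHermitian.eq, Complex.star_def, Complex.conj_ofReal]
  set U := hH.eigenvectorUnitary
  set p : κ → ι → ℝ := fun i k =>
    ((star (U : Matrix ι ι ℂ) * σ i * (U : Matrix ι ι ℂ)) k k).re with hp
  have htr : ∀ i, ∑ k, p i k = (σ i).trace.re := by
    intro i
    rw [← Complex.re_sum]
    congr 1
    change Matrix.trace _ = _
    rw [Matrix.trace_mul_comm, ← Matrix.mul_assoc, Matrix.mem_unitaryGroup_iff.1 U.2,
      Matrix.one_mul]
  have hp0 : ∀ i k, 0 ≤ p i k := by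
    intro i k
    have := ((hσ i).conjTranspose_mul_mul_same (U : Matrix ι ι ℂ)).diag_nonneg (i := k)
    exact (Complex.le_def.1 this).1
  have hl : ∀ k, ∑ i, c i * p i k = hH.eigenvalues k := by
    intro k
    have h1 : star (U : Matrix ι ι ℂ) * ρ * (U : Matrix ι ι ℂ) =
        Matrix.diagonal (fun j => (hH.eigenvalues j : ℂ)) := by
      have := hH.conjStarAlgAut_star_eigenvectorUnitary
      rw [Unitary.conjStarAlgAut_apply] at this
      simpa [Function.comp_def] using this
    have h2 := congrArg Complex.re (congrFun (congrFun h1 k) k)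
    rw [Matrix.diagonal_apply_eq, Complex.ofReal_re] at h2
    rw [← h2, hρ, Matrix.mul_sum, Matrix.sum_mul, Matrix.sum_apply, Complex.re_sum]
    refine Finset.sum_congr rfl fun i _ => ?_
    simp [hp]
  have hL : ρ.trace.re = ∑ k, ∑ i, c i * p i k := by
    rw [Finset.sum_congr rfl fun k _ => hl k, hH.trace_eq_sum_eigenvalues, Complex.re_sum]
    rfl
  have hlog : 0 < Real.log 2 := Real.log_pos (by norm_num)
  have h := sum_negMulLog_sub_superadditive c hc p hp0
  have h1 : ∀ i, homEntropy (σ i) ≤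
      (∑ k, Real.negMulLog (p i k) - Real.negMulLog (∑ k, p i k)) / Real.log 2 := by
    intro i
    rw [homEntropy, sub_div, htr]
    exact sub_le_sub_right (vonNeumann_le_shannon (hσ i) U) _
  calc ∑ i, c i * homEntropy (σ i)
      ≤ ∑ i, c i * ((∑ k, Real.negMulLog (p i k) - Real.negMulLog (∑ k, p i k)) / Real.log 2) :=
        Finset.sum_le_sum fun i _ => mul_le_mul_of_nonneg_left (h1 i) (hc i)
    _ = (∑ i, c i * (∑ k, Real.negMulLog (p i k) - Real.negMulLog (∑ k, p i k))) / Real.log 2 := by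
        rw [Finset.sum_div]
        exact Finset.sum_congr rfl fun i _ => by rw [mul_div_assoc]
    _ ≤ _ := div_le_div_of_nonneg_right h hlog.le
    _ = homEntropy ρ := by
        rw [homEntropy, hL, vonNeumann, dif_pos hH, shannon, sub_div]
        simp only [hl]

end Entropy

/-! ### The entropy of entanglement -/

section Entanglement

variable {ι κ μ ν : Type*} [Fintype ι] [Fintype κ] [Fintype μ] [Fintype ν]

theorem homEntropy_zero : homEntropy (0 : Matrix ι ι ℂ) = 0 := by
  have : (0 : Matrix ι ι ℂ) = Matrix.diagonal fun _ => ((0 : ℝ) : ℂ) := by simp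
  rw [homEntropy, this, vonNeumann_diagonal]
  simp [shannon]

/-- One inequality is superadditivity with a single summand; the other is the same applied to the
scalar `t⁻¹` and the matrix `t • σ`. -/
theorem homEntropy_smul {t : ℝ} (ht : 0 ≤ t) {σ : Matrix ι ι ℂ} (hσ : σ.PosSemidef) :
    homEntropy ((t : ℂ) • σ) = t * homEntropy σ := by
  have key : ∀ {s : ℝ}, 0 ≤ s → ∀ {τ : Matrix ι ι ℂ}, τ.PosSemidef →
      s * homEntropy τ ≤ homEntropy ((s : ℂ) • τ) := fun {s} hs {τ} hτ => by
    simpa using homEntropy_superadditive (κ := Unit) (fun _ => s) (fun _ => hs) (fun _ => τ)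
      fun _ => hτ
  rcases ht.eq_or_lt with rfl | h
  · simp [homEntropy_zero]
  · refine le_antisymm ?_ (key ht hσ)
    have h1 := key (inv_nonneg.2 ht) (hσ.smul (Complex.zero_le_real.2 ht))
    rw [smul_smul, ← Complex.ofReal_mul, inv_mul_cancel₀ h.ne', Complex.ofReal_one, one_smul] at h1
    rwa [inv_mul_le_iff₀ h] at h1

/-- The entropy of entanglement of an unnormalized bipartite pure state given by its matrix of
amplitudes, homogeneous of degree two in the state. -/
def entanglement (N : Matrix ι κ ℂ) : ℝ := homEntropy (N * Nᴴ)

theorem trace_mul_conjTranspose_re (N : Matrix ι κ ℂ) :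
    (N * Nᴴ).trace.re = ∑ i, ∑ j, ‖N i j‖ ^ 2 := by
  rw [Matrix.trace, Complex.re_sum]
  refine Finset.sum_congr rfl fun i _ => ?_
  rw [Matrix.diag_apply, Matrix.mul_apply, Complex.re_sum]
  refine Finset.sum_congr rfl fun j _ => ?_
  rw [Matrix.conjTranspose_apply, Complex.star_def, Complex.mul_conj, Complex.ofReal_re,
    Complex.normSq_eq_norm_sq]

theorem vonNeumann_mul_conjTranspose (N : Matrix ι κ ℂ) :
    vonNeumann (N * Nᴴ) =
      entanglement N + Real.negMulLog (∑ i, ∑ j, ‖N i j‖ ^ 2) / Real.log 2 := by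
  rw [entanglement, homEntropy, trace_mul_conjTranspose_re]
  ring

theorem entanglement_eq_conjTranspose_mul (N : Matrix ι κ ℂ) :
    entanglement N = homEntropy (Nᴴ * N) := by
  rw [entanglement, homEntropy, homEntropy, vonNeumann_mul_conjTranspose_comm,
    Matrix.trace_mul_comm]

theorem entanglement_transpose (N : Matrix ι κ ℂ) : entanglement Nᵀ = entanglement N := by
  rw [entanglement_eq_conjTranspose_mul N, entanglement]
  have : Nᵀ * Nᵀᴴ = (Nᴴ * N)ᵀ := by rw [Matrix.transpose_mul]; rfl
  rw [this, homEntropy, homEntropy,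
    vonNeumann_transpose (Matrix.isHermitian_conjTranspose_mul_self N), Matrix.trace_transpose]

theorem entanglement_smul (c : ℂ) (N : Matrix ι κ ℂ) :
    entanglement (c • N) = ‖c‖ ^ 2 * entanglement N := by
  rw [entanglement, entanglement, ← homEntropy_smul (sq_nonneg _)
    (Matrix.posSemidef_self_mul_conjTranspose N)]
  congr 1
  rw [Matrix.conjTranspose_smul, Matrix.smul_mul, Matrix.mul_smul, smul_smul, Complex.star_def,
    Complex.mul_conj, Complex.normSq_eq_norm_sq]

/-- Only the reduced states on the right factor are compared, so the left factors of `M` and the `N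
i` may differ. This is what allows Alice's alphabet to change while Bob's registers stay fixed. -/
theorem entanglement_superadditive (c : κ → ℝ) (hc : ∀ i, 0 ≤ c i) (N : κ → Matrix ι μ ℂ)
    {M : Matrix ν μ ℂ} (h : Mᴴ * M = ∑ i, (c i : ℂ) • ((N i)ᴴ * N i)) :
    ∑ i, c i * entanglement (N i) ≤ entanglement M := by
  simp only [entanglement_eq_conjTranspose_mul, h]
  exact homEntropy_superadditive c hc _ fun i => Matrix.posSemidef_conjTranspose_mul_self _

/-- With a one-dimensional factor every vector is a product. -/
theorem entanglement_of_unique [Unique ι] (N : Matrix ι κ ℂ) : entanglement N = 0 := by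
  have : N * Nᴴ = Matrix.diagonal fun _ => (((∑ i, ∑ j, ‖N i j‖ ^ 2 : ℝ)) : ℂ) := by
    ext i j
    obtain rfl := Unique.eq_default i
    obtain rfl := Unique.eq_default j
    rw [Matrix.diagonal_apply_eq, Fintype.sum_unique, Matrix.mul_apply, Complex.ofReal_sum]
    refine Finset.sum_congr rfl fun j _ => ?_
    rw [Matrix.conjTranspose_apply, Complex.star_def, Complex.mul_conj,
      Complex.normSq_eq_norm_sq]
  rw [entanglement, homEntropy, trace_mul_conjTranspose_re, this, vonNeumann_diagonal]
  simp [shannon]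

end Entanglement

/-! ### Mutual informations of a bipartite state in terms of entanglement -/

section Info

universe w

variable {X Y : Type*} {A' B' : Type w} [Fintype X] [Fintype Y] [Fintype A'] [Fintype B']

/-- The unnormalized state of `A'` and Bob's registers after the outcome `x` of measuring `A`. -/
def rowSlice {R : Type*} (M : Matrix (X × A') R ℂ) (x : X) : Matrix A' R ℂ :=
  M.submatrix (fun a => (x, a)) id

/-- The unnormalized state of Alice's registers and `B'` after the outcome `y` of measuring `B`. -/
def colSlice {L : Type*} (M : Matrix L (Y × B') ℂ) (y : Y) : Matrix L B' ℂ :=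
  M.submatrix id fun b => (y, b)

/-- The matrix of amplitudes of a bipartite vector. -/
def amplitudes {L R : Type*} (ψ : EuclideanSpace ℂ (L × R)) : Matrix L R ℂ :=
  Matrix.of fun i j => ψ (i, j)

variable {P : X × Y → ℝ} {ψ : EuclideanSpace ℂ ((X × A') × (Y × B'))}

omit [Fintype X] in
theorem sum_norm_rowSlice (h : ∀ x y, ∑ a, ∑ b, ‖ψ ((x, a), (y, b))‖ ^ 2 = P (x, y)) (x : X) :
    ∑ a, ∑ r, ‖rowSlice (amplitudes ψ) x a r‖ ^ 2 = margFst P x := by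
  simp only [rowSlice, amplitudes, Matrix.submatrix_apply, Matrix.of_apply, id,
    Fintype.sum_prod_type, margFst, ← h]
  exact Finset.sum_comm

omit [Fintype Y] in
theorem sum_norm_colSlice (h : ∀ x y, ∑ a, ∑ b, ‖ψ ((x, a), (y, b))‖ ^ 2 = P (x, y)) (y : Y) :
    ∑ l, ∑ b, ‖colSlice (amplitudes ψ) y l b‖ ^ 2 = margSnd P y := by
  simp only [colSlice, amplitudes, Matrix.submatrix_apply, Matrix.of_apply, id,
    Fintype.sum_prod_type, margSnd, ← h]

omit [Fintype X] [Fintype Y] in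
theorem sum_norm_cell (h : ∀ x y, ∑ a, ∑ b, ‖ψ ((x, a), (y, b))‖ ^ 2 = P (x, y)) (x : X) (y : Y) :
    ∑ a, ∑ b, ‖colSlice (rowSlice (amplitudes ψ) x) y a b‖ ^ 2 = P (x, y) := h x y

theorem sum_norm_amplitudes (hP : P ∈ stdSimplex ℝ (X × Y))
    (h : ∀ x y, ∑ a, ∑ b, ‖ψ ((x, a), (y, b))‖ ^ 2 = P (x, y)) :
    ∑ l, ∑ r, ‖amplitudes ψ l r‖ ^ 2 = 1 := by
  rw [← hP.2, Fintype.sum_prod_type, Fintype.sum_prod_type]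
  exact Finset.sum_congr rfl fun x _ => sum_norm_rowSlice h x

theorem vonNeumann_outcomeA (h : ∀ x y, ∑ a, ∑ b, ‖ψ ((x, a), (y, b))‖ ^ 2 = P (x, y))
    {ρ : Matrix X X ℂ} (hρ : ∀ x x', ρ x x' = if x = x' then
      ∑ r : Y × B', ∑ a, ψ ((x, a), r) * star (ψ ((x', a), r)) else 0) :
    vonNeumann ρ = shannon (margFst P) := by
  rw [← vonNeumann_diagonal]
  congr 1
  ext x x'
  rw [hρ, Matrix.diagonal_apply]
  split_ifs with hx
  · subst hx
    rw [← sum_norm_rowSlice h, Finset.sum_comm]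
    push_cast
    refine Finset.sum_congr rfl fun a _ => Finset.sum_congr rfl fun r _ => ?_
    rw [Complex.star_def, Complex.mul_conj, Complex.normSq_eq_norm_sq]
    push_cast
    rfl
  · rfl

theorem vonNeumann_outcomeB (h : ∀ x y, ∑ a, ∑ b, ‖ψ ((x, a), (y, b))‖ ^ 2 = P (x, y))
    {ρ : Matrix Y Y ℂ} (hρ : ∀ y y', ρ y y' = if y = y' then
      ∑ l : X × A', ∑ b, ψ (l, (y, b)) * star (ψ (l, (y', b))) else 0) :
    vonNeumann ρ = shannon (margSnd P) := by
  rw [← vonNeumann_diagonal]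
  congr 1
  ext y y'
  rw [hρ, Matrix.diagonal_apply]
  split_ifs with hy
  · subst hy
    rw [← sum_norm_colSlice h]
    push_cast
    refine Finset.sum_congr rfl fun a _ => Finset.sum_congr rfl fun r _ => ?_
    rw [Complex.star_def, Complex.mul_conj, Complex.normSq_eq_norm_sq]
    push_cast
    rfl
  · rfl

/-- Given the outcome `x`, the state on `A'BB'` is pure, so the blocks of the state of `X` and `BB'`
have the entropies of row slices. The Shannon terms of the blocks add up to H(X) and cancel. -/
theorem infoX_BB'_eq (hP : P ∈ stdSimplex ℝ (X × Y))
    (h : ∀ x y, ∑ a, ∑ b, ‖ψ ((x, a), (y, b))‖ ^ 2 = P (x, y)) :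
    infoX_BB' ψ =
      entanglement (amplitudes ψ) - ∑ x, entanglement (rowSlice (amplitudes ψ) x) := by
  have h1 : vonNeumann (traceRight (discardA' (measureA (pureState ψ)))) =
      shannon (margFst P) := vonNeumann_outcomeA h fun x x' => by
    simp only [traceRight, discardA', measureA, pureState, Matrix.of_apply]
    split_ifs <;> simp
  have h2 : traceLeft (discardA' (measureA (pureState ψ))) =
      (amplitudes ψ)ᵀ * (amplitudes ψ)ᵀᴴ := by
    ext r r'
    simp [traceLeft, discardA', measureA, pureState, Matrix.mul_apply, amplitudes,
      Fintype.sum_prod_type]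
  have h3 : vonNeumann (discardA' (measureA (pureState ψ))) =
      ∑ x, vonNeumann ((rowSlice (amplitudes ψ) x)ᵀ * (rowSlice (amplitudes ψ) x)ᵀᴴ) :=
    vonNeumann_block (Equiv.prodComm _ _) _
      (fun x => Matrix.isHermitian_mul_conjTranspose_self _) fun ⟨x, _⟩ ⟨x', _⟩ => by
        by_cases hx : x = x'
        · simp [discardA', measureA, pureState, Matrix.mul_apply, amplitudes, rowSlice, hx]
        · simp [discardA', measureA, hx]
  rw [infoX_BB', mutualInfo, h1, h2, h3]
  simp only [vonNeumann_mul_conjTranspose, entanglement_transpose, Matrix.transpose_apply]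
  rw [Finset.sum_comm, sum_norm_amplitudes hP h, Finset.sum_add_distrib]
  have : ∀ x, ∑ i, ∑ j, ‖rowSlice (amplitudes ψ) x j i‖ ^ 2 = margFst P x := fun x => by
    rw [Finset.sum_comm, sum_norm_rowSlice h]
  simp only [this, ← Finset.sum_div, shannon, Real.negMulLog_one]
  ring

theorem infoAA'_Y_eq (hP : P ∈ stdSimplex ℝ (X × Y))
    (h : ∀ x y, ∑ a, ∑ b, ‖ψ ((x, a), (y, b))‖ ^ 2 = P (x, y)) :
    infoAA'_Y ψ =
      entanglement (amplitudes ψ) - ∑ y, entanglement (colSlice (amplitudes ψ) y) := by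
  have h1 : vonNeumann (traceLeft (discardB' (measureB (pureState ψ)))) =
      shannon (margSnd P) := vonNeumann_outcomeB h fun x x' => by
    simp only [traceLeft, discardB', measureB, pureState, Matrix.of_apply]
    split_ifs <;> simp
  have h2 : traceRight (discardB' (measureB (pureState ψ))) =
      amplitudes ψ * (amplitudes ψ)ᴴ := by
    ext r r'
    simp [traceRight, discardB', measureB, pureState, Matrix.mul_apply, amplitudes,
      Fintype.sum_prod_type]
  have h3 : vonNeumann (discardB' (measureB (pureState ψ))) =
      ∑ y, vonNeumann (colSlice (amplitudes ψ) y * (colSlice (amplitudes ψ) y)ᴴ) :=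
    vonNeumann_block (Equiv.refl _) _
      (fun x => Matrix.isHermitian_mul_conjTranspose_self _) fun ⟨_, y⟩ ⟨_, y'⟩ => by
        by_cases hy : y = y'
        · simp [discardB', measureB, pureState, Matrix.mul_apply, amplitudes, colSlice, hy]
        · simp [discardB', measureB, hy]
  rw [infoAA'_Y, mutualInfo, h1, h2, h3]
  simp only [vonNeumann_mul_conjTranspose, sum_norm_amplitudes hP h, Finset.sum_add_distrib,
    sum_norm_colSlice h, ← Finset.sum_div, shannon, Real.negMulLog_one]
  ring

theorem infoX_YB'_eq (h : ∀ x y, ∑ a, ∑ b, ‖ψ ((x, a), (y, b))‖ ^ 2 = P (x, y)) :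
    infoX_YB' ψ = classicalInfo P + (∑ y, entanglement (colSlice (amplitudes ψ) y) -
      ∑ x, ∑ y, entanglement (colSlice (rowSlice (amplitudes ψ) x) y)) := by
  have h1 : vonNeumann (traceRight (discardA' (measureA (measureB (pureState ψ))))) =
      shannon (margFst P) := vonNeumann_outcomeA h fun x x' => by
    simp only [traceRight, discardA', measureA, measureB, pureState, Matrix.of_apply]
    split_ifs <;> simp
  have h2 : vonNeumann (traceLeft (discardA' (measureA (measureB (pureState ψ))))) =
      ∑ y, vonNeumann ((colSlice (amplitudes ψ) y)ᵀ * (colSlice (amplitudes ψ) y)ᵀᴴ) :=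
    vonNeumann_block (Equiv.prodComm _ _) _
      (fun x => Matrix.isHermitian_mul_conjTranspose_self _) fun ⟨y, _⟩ ⟨y', _⟩ => by
        by_cases hy : y = y'
        · simp [traceLeft, discardA', measureA, measureB, pureState, Matrix.mul_apply, amplitudes,
            colSlice, hy, Fintype.sum_prod_type]
        · simp [traceLeft, discardA', measureA, measureB, hy]
  have h3 : vonNeumann (discardA' (measureA (measureB (pureState ψ)))) =
      ∑ z : X × Y, vonNeumann ((colSlice (rowSlice (amplitudes ψ) z.1) z.2)ᵀ *
        (colSlice (rowSlice (amplitudes ψ) z.1) z.2)ᵀᴴ) :=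
    vonNeumann_block ((Equiv.prodAssoc _ _ _).symm.trans (Equiv.prodComm _ _))
      (fun z : X × Y => _)
      (fun x => Matrix.isHermitian_mul_conjTranspose_self _) fun ⟨x, y, _⟩ ⟨x', y', _⟩ => by
        by_cases hx : x = x' <;> by_cases hy : y = y' <;>
          simp [discardA', measureA, measureB, pureState, Matrix.mul_apply, amplitudes, rowSlice,
            colSlice, hx, hy]
  rw [infoX_YB', mutualInfo, h1, h2, h3]
  simp only [vonNeumann_mul_conjTranspose, entanglement_transpose, Matrix.transpose_apply]
  have h4 : ∀ y, ∑ i, ∑ j, ‖colSlice (amplitudes ψ) y j i‖ ^ 2 = margSnd P y := fun y => by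
    rw [Finset.sum_comm, sum_norm_colSlice h]
  have h5 : ∀ z : X × Y, ∑ i, ∑ j, ‖colSlice (rowSlice (amplitudes ψ) z.1) z.2 j i‖ ^ 2 = P z :=
    fun z => by rw [Finset.sum_comm, sum_norm_cell h]
  simp only [h4, h5, Finset.sum_add_distrib, ← Finset.sum_div, shannon, classicalInfo]
  rw [Fintype.sum_prod_type]
  ring

theorem infoXA'_Y_eq (h : ∀ x y, ∑ a, ∑ b, ‖ψ ((x, a), (y, b))‖ ^ 2 = P (x, y)) :
    infoXA'_Y ψ = classicalInfo P + (∑ x, entanglement (rowSlice (amplitudes ψ) x) -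
      ∑ x, ∑ y, entanglement (colSlice (rowSlice (amplitudes ψ) x) y)) := by
  have h1 : vonNeumann (traceLeft (discardB' (measureA (measureB (pureState ψ))))) =
      shannon (margSnd P) := vonNeumann_outcomeB h fun x x' => by
    simp only [traceLeft, discardB', measureA, measureB, pureState, Matrix.of_apply]
    split_ifs <;> simp
  have h2 : vonNeumann (traceRight (discardB' (measureA (measureB (pureState ψ))))) =
      ∑ x, vonNeumann (rowSlice (amplitudes ψ) x * (rowSlice (amplitudes ψ) x)ᴴ) :=
    vonNeumann_block (Equiv.prodComm _ _) _
      (fun x => Matrix.isHermitian_mul_conjTranspose_self _) fun ⟨x, _⟩ ⟨x', _⟩ => by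
        by_cases hx : x = x'
        · simp [traceRight, discardB', measureA, measureB, pureState, Matrix.mul_apply, amplitudes,
            rowSlice, hx, Fintype.sum_prod_type]
        · simp [traceRight, discardB', measureA, measureB, hx]
  have h3 : vonNeumann (discardB' (measureA (measureB (pureState ψ)))) =
      ∑ z : Y × X, vonNeumann (colSlice (rowSlice (amplitudes ψ) z.2) z.1 *
        (colSlice (rowSlice (amplitudes ψ) z.2) z.1)ᴴ) :=
    vonNeumann_block ((Equiv.prodComm _ _).trans ((Equiv.prodAssoc _ _ _).symm.trans
        (Equiv.prodComm _ _)))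
      (fun z : Y × X => _)
      (fun x => Matrix.isHermitian_mul_conjTranspose_self _) fun ⟨⟨x, _⟩, y⟩ ⟨⟨x', _⟩, y'⟩ => by
        by_cases hx : x = x' <;> by_cases hy : y = y' <;>
          simp [discardB', measureA, measureB, pureState, Matrix.mul_apply, amplitudes, rowSlice,
            colSlice, hx, hy]
  rw [infoXA'_Y, mutualInfo, h1, h2, h3]
  simp only [vonNeumann_mul_conjTranspose, sum_norm_rowSlice h, sum_norm_cell h,
    Finset.sum_add_distrib, ← Finset.sum_div, shannon, classicalInfo]
  rw [Fintype.sum_prod_type_right, Fintype.sum_prod_type_right, Fintype.sum_prod_type]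
  ring

/-- The entropic conditions become equalities between sums over slices, a form that can be averaged
over selections. -/
theorem isEmbedding_iff (h : ∀ x y, ∑ a, ∑ b, ‖ψ ((x, a), (y, b))‖ ^ 2 = P (x, y)) :
    IsEmbedding P ψ ↔
      ∑ x, entanglement (rowSlice (amplitudes ψ) x) =
        ∑ x, ∑ y, entanglement (colSlice (rowSlice (amplitudes ψ) x) y) ∧
      ∑ y, entanglement (colSlice (amplitudes ψ) y) =
        ∑ x, ∑ y, entanglement (colSlice (rowSlice (amplitudes ψ) x) y) := by
  refine ⟨fun hψ => ⟨?_, ?_⟩, fun ⟨h1, h2⟩ => ⟨h, ?_, ?_⟩⟩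
  · have := hψ.infoA
    rw [infoXA'_Y_eq h] at this
    linarith
  · have := hψ.infoB
    rw [infoX_YB'_eq h] at this
    linarith
  · rw [infoX_YB'_eq h, h2, sub_self, add_zero]
  · rw [infoXA'_Y_eq h, h1, sub_self, add_zero]

/-- The two leakages of an embedding coincide. -/
theorem leakage_eq (hP : P ∈ stdSimplex ℝ (X × Y)) (hψ : IsEmbedding P ψ) :
    leakage P ψ = entanglement (amplitudes ψ) -
      ∑ x, ∑ y, entanglement (colSlice (rowSlice (amplitudes ψ) x) y) - classicalInfo P := by
  have h := (isEmbedding_iff hψ.outcome).1 hψ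
  rw [leakage, infoX_BB'_eq hP hψ.outcome, infoAA'_Y_eq hP hψ.outcome, h.1, h.2, max_self]

end Info

/-! ### Random selection of representatives -/

section Selection

variable {X C : Type*} [Fintype X] [Fintype C]

/-- The probability of the selection `g` when the values `g c` are drawn independently with
distributions `u c`. -/
def selectionWeight (u : C → X → ℝ) (g : C → X) : ℝ := ∏ c, u c (g c)

variable {u : C → X → ℝ}

omit [Fintype X] in
theorem selectionWeight_nonneg (hu : ∀ c x, 0 ≤ u c x) (g : C → X) : 0 ≤ selectionWeight u g :=
  Finset.prod_nonneg fun c _ => hu c (g c)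

theorem sum_selectionWeight (h1 : ∀ c, ∑ x, u c x = 1) : ∑ g, selectionWeight u g = 1 := by
  have := Finset.prod_univ_sum (fun _ : C => (Finset.univ : Finset X)) u
  rw [Fintype.piFinset_univ] at this
  rw [show ∑ g, selectionWeight u g = ∑ g : C → X, ∏ c, u c (g c) from rfl, ← this]
  simp [h1]

/-- The coordinate `g c₀` has law `u c₀`; the other factors sum to one. -/
theorem sum_selectionWeight_mul (h1 : ∀ c, ∑ x, u c x = 1) (c₀ : C) (F : X → ℂ) :
    ∑ g, (selectionWeight u g : ℂ) * F (g c₀) = ∑ x, (u c₀ x : ℂ) * F x := by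
  have := Finset.prod_univ_sum (fun _ : C => (Finset.univ : Finset X))
    fun c x => (u c x : ℂ) * if c = c₀ then F x else 1
  rw [Fintype.piFinset_univ, Finset.prod_eq_single c₀] at this
  · simp only [if_true] at this
    rw [this]
    refine Finset.sum_congr rfl fun g _ => ?_
    rw [Finset.prod_mul_distrib, Finset.prod_ite_eq' Finset.univ c₀ fun c => F (g c),
      if_pos (Finset.mem_univ _), selectionWeight, Complex.ofReal_prod]
  · intro c _ hc
    simp only [if_neg hc, mul_one]
    rw [← Complex.ofReal_sum, h1, Complex.ofReal_one]
  · simp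

/-- Averaging over the random selection of representatives, reweighted by their probabilities,
recovers the sum over everything. -/
theorem sum_selection (h1 : ∀ c, ∑ x, u c x = 1) (F : X → ℂ)
    (hF : ∀ x, F x = 0 ∨ ∃! c, u c x ≠ 0) :
    ∑ g, (selectionWeight u g : ℂ) * ∑ c, ((u c (g c))⁻¹ : ℝ) * F (g c) = ∑ x, F x := by
  simp only [Finset.mul_sum]
  rw [Finset.sum_comm]
  have : ∀ c, ∑ g, (selectionWeight u g : ℂ) * (((u c (g c))⁻¹ : ℝ) * F (g c)) =
      ∑ x, (u c x : ℂ) * (((u c x)⁻¹ : ℝ) * F x) := fun c =>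
    sum_selectionWeight_mul h1 c fun x => ((u c x)⁻¹ : ℝ) * F x
  rw [Finset.sum_congr rfl fun c _ => this c, Finset.sum_comm]
  refine Finset.sum_congr rfl fun x _ => ?_
  -- Where `F x ≠ 0`, the value `x` lies in exactly one class, and there the inverse weight cancels
  -- its probability.
  rcases hF x with h0 | ⟨c, hc, huniq⟩
  · simp [h0]
  · rw [Finset.sum_eq_single c]
    · rw [← mul_assoc, ← Complex.ofReal_mul, mul_inv_cancel₀ hc, Complex.ofReal_one, one_mul]
    · intro c' _ hne
      have : u c' x = 0 := by
        by_contra h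
        exact hne (huniq c' h)
      simp [this]
    · simp

theorem sum_selection_real (h1 : ∀ c, ∑ x, u c x = 1) (F : X → ℝ)
    (hF : ∀ x, F x = 0 ∨ ∃! c, u c x ≠ 0) :
    ∑ g, selectionWeight u g * ∑ c, (u c (g c))⁻¹ * F (g c) = ∑ x, F x := by
  have := sum_selection h1 (fun x => (F x : ℂ)) fun x => (hF x).imp (fun h => by simp [h]) id
  exact_mod_cast this

/-- Positivity of the weight is part of the conclusion, since the properties of selections hold only
on the support. -/
theorem exists_le_of_weighted_sum_le {I : Type*} [Fintype I] {W f : I → ℝ} (hW : ∀ i, 0 ≤ W i)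
    (h1 : ∑ i, W i = 1) {K : ℝ} (h : ∑ i, W i * f i ≤ K) : ∃ i, 0 < W i ∧ f i ≤ K := by
  by_contra! hcon
  have h2 : ∑ i, W i * f i > ∑ i, W i * K := by
    obtain ⟨i, -, hi⟩ := Finset.exists_ne_zero_of_sum_ne_zero (h1.trans_ne one_ne_zero)
    have hi : 0 < W i := lt_of_le_of_ne (hW i) hi.symm
    refine Finset.sum_lt_sum (fun j _ => ?_)
      ⟨i, Finset.mem_univ i, mul_lt_mul_of_pos_left (hcon i hi) hi⟩
    rcases (hW j).eq_or_lt with h0 | h0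
    · simp [← h0]
    · exact mul_le_mul_of_nonneg_left (hcon j h0).le h0.le
  rw [← Finset.sum_mul, h1, one_mul] at h2
  exact absurd h h2.not_ge

end Selection

/-! ### Selected states -/

section SelectedState

variable {X Y C D A' B' L R : Type*} [Fintype X] [Fintype Y] [Fintype C] [Fintype D]
  [Fintype A'] [Fintype B'] [Fintype L] [Fintype R]

/-- Restriction of Alice's register to the selected values `g c`, reweighted. -/
def selectRow (u : C → X → ℝ) (g : C → X) (M : Matrix (X × A') R ℂ) : Matrix (C × A') R ℂ :=
  Matrix.of fun i r => ((Real.sqrt (u i.1 (g i.1)))⁻¹ : ℝ) * M (g i.1, i.2) r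

/-- Restriction of Bob's register to the selected values `h d`, reweighted. -/
def selectCol (v : D → Y → ℝ) (h : D → Y) (M : Matrix L (Y × B') ℂ) : Matrix L (D × B') ℂ :=
  (selectRow v h Mᵀ)ᵀ

omit [Fintype R] in
theorem conjTranspose_mul_eq_sum_rowSlice (M : Matrix (X × A') R ℂ) :
    Mᴴ * M = ∑ x, (rowSlice M x)ᴴ * rowSlice M x := by
  ext r r'
  simp [Matrix.sum_apply, Matrix.mul_apply, rowSlice, Fintype.sum_prod_type]

omit [Fintype X] [Fintype C] [Fintype A'] [Fintype R] in
theorem rowSlice_selectRow (u : C → X → ℝ) (g : C → X) (M : Matrix (X × A') R ℂ) (c : C) :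
    rowSlice (selectRow u g M) c =
      (((Real.sqrt (u c (g c)))⁻¹ : ℝ) : ℂ) • rowSlice M (g c) := rfl

omit [Fintype X] [Fintype C] in
theorem entanglement_rowSlice_selectRow {u : C → X → ℝ} (hu : ∀ c x, 0 ≤ u c x) (g : C → X)
    (M : Matrix (X × A') R ℂ) (c : C) :
    entanglement (rowSlice (selectRow u g M) c) =
      (u c (g c))⁻¹ * entanglement (rowSlice M (g c)) := by
  rw [rowSlice_selectRow, entanglement_smul, Complex.norm_real, Real.norm_eq_abs, sq_abs, inv_pow,
    Real.sq_sqrt (hu _ _)]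

omit [Fintype Y] [Fintype D] in
theorem entanglement_colSlice_selectCol {v : D → Y → ℝ} (hv : ∀ d y, 0 ≤ v d y) (h : D → Y)
    (M : Matrix L (Y × B') ℂ) (d : D) :
    entanglement (colSlice (selectCol v h M) d) =
      (v d (h d))⁻¹ * entanglement (colSlice M (h d)) := by
  rw [← entanglement_transpose, ← entanglement_transpose (colSlice M (h d))]
  exact entanglement_rowSlice_selectRow hv h Mᵀ d

/-- The slices' reduced states on the right sum to that of `M`: a local measurement does not
increase entanglement on average. -/
theorem sum_entanglement_rowSlice_le (M : Matrix (X × A') R ℂ) :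
    ∑ x, entanglement (rowSlice M x) ≤ entanglement M := by
  have := entanglement_superadditive (fun _ : X => (1 : ℝ)) (fun _ => zero_le_one)
    (fun x => rowSlice M x) (M := M) (by simp [conjTranspose_mul_eq_sum_rowSlice])
  simpa using this

theorem sum_entanglement_colSlice_le (M : Matrix L (Y × B') ℂ) :
    ∑ y, entanglement (colSlice M y) ≤ entanglement M := by
  have := sum_entanglement_rowSlice_le Mᵀ
  rw [entanglement_transpose] at this
  refine le_trans (le_of_eq (Finset.sum_congr rfl fun y _ => ?_)) this
  rw [← entanglement_transpose]
  rfl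

/-- The inverse square roots in `selectRow` make the reduced states on the right average exactly to
that of `M`. -/
theorem sum_entanglement_selectRow_le {u : C → X → ℝ} (hu : ∀ c x, 0 ≤ u c x)
    (h1 : ∀ c, ∑ x, u c x = 1) {M : Matrix (X × A') R ℂ}
    (hM : ∀ x, rowSlice M x = 0 ∨ ∃! c, u c x ≠ 0) :
    ∑ g, selectionWeight u g * entanglement (selectRow u g M) ≤ entanglement M := by
  refine entanglement_superadditive _ (selectionWeight_nonneg hu) _ ?_
  ext r r'
  have h := sum_selection h1 (fun x => ((rowSlice M x)ᴴ * rowSlice M x) r r')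
    fun x => (hM x).imp (fun h => by simp [h]) id
  rw [conjTranspose_mul_eq_sum_rowSlice, Matrix.sum_apply, ← h, Matrix.sum_apply]
  refine Finset.sum_congr rfl fun g _ => ?_
  rw [Matrix.smul_apply, conjTranspose_mul_eq_sum_rowSlice, Matrix.sum_apply, smul_eq_mul]
  congr 1
  refine Finset.sum_congr rfl fun c _ => ?_
  rw [rowSlice_selectRow, Matrix.conjTranspose_smul, Matrix.smul_mul, Matrix.mul_smul, smul_smul,
    Complex.star_def, Complex.conj_ofReal, ← Complex.ofReal_mul, ← mul_inv,
    Real.mul_self_sqrt (hu _ _), Matrix.smul_apply, smul_eq_mul]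

theorem sum_entanglement_selectCol_le {v : D → Y → ℝ} (hv : ∀ d y, 0 ≤ v d y)
    (h1 : ∀ d, ∑ y, v d y = 1) {M : Matrix L (Y × B') ℂ}
    (hM : ∀ y, colSlice M y = 0 ∨ ∃! d, v d y ≠ 0) :
    ∑ h, selectionWeight v h * entanglement (selectCol v h M) ≤ entanglement M := by
  refine le_of_le_of_eq ?_ (entanglement_transpose M)
  simp only [selectCol, entanglement_transpose (selectRow _ _ _)]
  exact sum_entanglement_selectRow_le (M := Mᵀ) hv h1 fun y =>
    (hM y).imp (fun h => show (colSlice M y)ᵀ = 0 by rw [h, Matrix.transpose_zero]) id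

omit [Fintype X] [Fintype Y] [Fintype C] [Fintype D] [Fintype A'] [Fintype B'] in
theorem selectCol_selectRow (u : C → X → ℝ) (v : D → Y → ℝ) (g : C → X) (h : D → Y)
    (M : Matrix (X × A') (Y × B') ℂ) :
    selectCol v h (selectRow u g M) = selectRow u g (selectCol v h M) := by
  ext i j
  exact mul_left_comm _ _ _

/-- The total entanglement left when both registers are measured. -/
def cellEntanglement (M : Matrix (X × A') (Y × B') ℂ) : ℝ :=
  ∑ x, ∑ y, entanglement (colSlice (rowSlice M x) y)

/-- The equalities `hrow` and `hcol` are inherited by every selection of positive weight, so the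
leakage bound can be met without losing them. -/
theorem exists_selection {u : C → X → ℝ} {v : D → Y → ℝ} (hu : ∀ c x, 0 ≤ u c x)
    (hu1 : ∀ c, ∑ x, u c x = 1) (hv : ∀ d y, 0 ≤ v d y) (hv1 : ∀ d, ∑ y, v d y = 1)
    {M : Matrix (X × A') (Y × B') ℂ} (hMu : ∀ x, rowSlice M x = 0 ∨ ∃! c, u c x ≠ 0)
    (hMv : ∀ y, colSlice M y = 0 ∨ ∃! d, v d y ≠ 0)
    (hrow : ∑ x, entanglement (rowSlice M x) = cellEntanglement M)
    (hcol : ∑ y, entanglement (colSlice M y) = cellEntanglement M) :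
    ∃ (g : C → X) (h : D → Y), (∀ c, 0 < u c (g c)) ∧ (∀ d, 0 < v d (h d)) ∧
      ∑ c, entanglement (rowSlice (selectCol v h (selectRow u g M)) c) =
        cellEntanglement (selectCol v h (selectRow u g M)) ∧
      ∑ d, entanglement (colSlice (selectCol v h (selectRow u g M)) d) =
        cellEntanglement (selectCol v h (selectRow u g M)) ∧
      entanglement (selectCol v h (selectRow u g M)) -
        cellEntanglement (selectCol v h (selectRow u g M)) ≤
          entanglement M - cellEntanglement M := by
  set N : (C → X) → (D → Y) → Matrix (C × A') (D × B') ℂ :=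
    fun g h => selectCol v h (selectRow u g M) with hN
  have hwu := selectionWeight_nonneg hu
  have hwv := selectionWeight_nonneg hv
  set W : (C → X) × (D → Y) → ℝ := fun i => selectionWeight u i.1 * selectionWeight v i.2 with hWdef
  have hW : ∀ i, 0 ≤ W i := fun i => mul_nonneg (hwu _) (hwv _)
  have hW1 : ∑ i, W i = 1 := by
    rw [Fintype.sum_prod_type]
    simp only [hWdef, ← Finset.mul_sum, sum_selectionWeight hv1, mul_one, sum_selectionWeight hu1]
  have hE : ∑ i, W i * entanglement (N i.1 i.2) ≤ entanglement M := by
    rw [Fintype.sum_prod_type]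
    refine le_trans (Finset.sum_le_sum fun g _ => ?_) (sum_entanglement_selectRow_le hu hu1 hMu)
    simp only [hWdef, mul_assoc, ← Finset.mul_sum]
    refine mul_le_mul_of_nonneg_left (sum_entanglement_selectCol_le hv hv1 fun y => ?_) (hwu g)
    refine (hMv y).imp (fun h => ?_) id
    ext i b
    have : M (g i.1, i.2) (y, b) = 0 := congrFun (congrFun h _) b
    simp [colSlice, selectRow, this]
  have hcell : ∀ g h, cellEntanglement (N g h) =
      ∑ c, (u c (g c))⁻¹ * ∑ d, (v d (h d))⁻¹ *
        entanglement (colSlice (rowSlice M (g c)) (h d)) := by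
    intro g h
    refine Finset.sum_congr rfl fun c _ => ?_
    rw [Finset.mul_sum]
    refine Finset.sum_congr rfl fun d _ => ?_
    have h1 : colSlice (rowSlice (N g h) c) d =
      colSlice (selectCol v h (rowSlice (selectRow u g M) c)) d := rfl
    have h2 : colSlice (rowSlice (selectRow u g M) c) (h d) =
      rowSlice (selectRow u g (colSlice M (h d))) c := rfl
    rw [h1, entanglement_colSlice_selectCol hv, h2, entanglement_rowSlice_selectRow hu,
      mul_left_comm]
    rfl
  -- A cell is merely rescaled by the inverse weights, so its mean is preserved exactly; no
  -- concavity enters.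
  have hD : ∑ i, W i * cellEntanglement (N i.1 i.2) = cellEntanglement M := by
    rw [cellEntanglement, ← sum_selection_real hu1
      (fun x => ∑ y, entanglement (colSlice (rowSlice M x) y)) fun x => (hMu x).imp (fun h => by
        simp [h, colSlice, entanglement, homEntropy_zero]) id, Fintype.sum_prod_type]
    refine Finset.sum_congr rfl fun g _ => ?_
    simp only [hWdef, mul_assoc, ← Finset.mul_sum, hcell]
    congr 1
    simp only [Finset.mul_sum _ _ (selectionWeight v _)]
    rw [Finset.sum_comm]
    refine Finset.sum_congr rfl fun c _ => ?_
    simp only [mul_left_comm _ (u c (g c))⁻¹, ← Finset.mul_sum _ _ (u c (g c))⁻¹]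
    rw [sum_selection_real hv1 (fun y => entanglement (colSlice (rowSlice M (g c)) y))
      fun y => (hMv y).imp (fun h => ?_) id]
    have : colSlice (rowSlice M (g c)) y = rowSlice (colSlice M y) (g c) := rfl
    rw [this, h]
    simp [rowSlice, entanglement, homEntropy_zero]
  have hC : ∑ i, W i * ∑ d, entanglement (colSlice (N i.1 i.2) d) ≤
      ∑ y, entanglement (colSlice M y) := by
    rw [← sum_selection_real hv1 (fun y => entanglement (colSlice M y)) fun y => (hMv y).imp
      (fun h => by simp [h, entanglement, homEntropy_zero]) id, Fintype.sum_prod_type_right]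
    refine Finset.sum_le_sum fun h _ => ?_
    have hWc : ∀ g, W (g, h) = selectionWeight v h * selectionWeight u g := fun g => mul_comm _ _
    simp only [hWc, mul_assoc, ← Finset.mul_sum]
    refine mul_le_mul_of_nonneg_left ?_ (hwv h)
    simp only [Finset.mul_sum _ _ (selectionWeight u _)]
    rw [Finset.sum_comm]
    refine Finset.sum_le_sum fun d _ => ?_
    simp only [hN, entanglement_colSlice_selectCol hv, mul_left_comm _ (v d (h d))⁻¹,
      ← Finset.mul_sum _ _ (v d (h d))⁻¹]
    refine mul_le_mul_of_nonneg_left ?_ (inv_nonneg.2 (hv _ _))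
    refine sum_entanglement_selectRow_le hu hu1 (M := colSlice M (h d)) fun x =>
      (hMu x).imp (fun hx => ?_) id
    change colSlice (rowSlice M x) (h d) = 0
    rw [hx]
    rfl
  have hR : ∑ i, W i * ∑ c, entanglement (rowSlice (N i.1 i.2) c) ≤
      ∑ x, entanglement (rowSlice M x) := by
    rw [← sum_selection_real hu1 (fun x => entanglement (rowSlice M x)) fun x => (hMu x).imp
      (fun h => by simp [h, entanglement, homEntropy_zero]) id, Fintype.sum_prod_type]
    refine Finset.sum_le_sum fun g _ => ?_
    simp only [hWdef, mul_assoc, ← Finset.mul_sum]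
    refine mul_le_mul_of_nonneg_left ?_ (hwu g)
    simp only [Finset.mul_sum _ _ (selectionWeight v _)]
    rw [Finset.sum_comm]
    refine Finset.sum_le_sum fun c _ => ?_
    simp only [hN, selectCol_selectRow, entanglement_rowSlice_selectRow hu,
      mul_left_comm _ (u c (g c))⁻¹, ← Finset.mul_sum _ _ (u c (g c))⁻¹]
    refine mul_le_mul_of_nonneg_left ?_ (inv_nonneg.2 (hu _ _))
    refine sum_entanglement_selectCol_le hv hv1 (M := rowSlice M (g c)) fun y =>
      (hMv y).imp (fun hy => ?_) id
    change rowSlice (colSlice M y) (g c) = 0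
    rw [hy]
    rfl
  have hCle : ∀ i, 0 ≤ W i * (∑ d, entanglement (colSlice (N i.1 i.2) d) -
      cellEntanglement (N i.1 i.2)) := fun i => mul_nonneg (hW i) <| sub_nonneg.2 <| by
    rw [cellEntanglement, Finset.sum_comm]
    exact Finset.sum_le_sum fun d _ => sum_entanglement_rowSlice_le (colSlice (N i.1 i.2) d)
  have hRle : ∀ i, 0 ≤ W i * (∑ c, entanglement (rowSlice (N i.1 i.2) c) -
      cellEntanglement (N i.1 i.2)) := fun i => mul_nonneg (hW i) <| sub_nonneg.2 <|
    Finset.sum_le_sum fun c _ => sum_entanglement_colSlice_le (rowSlice (N i.1 i.2) c)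
  -- A nonnegative gap whose mean is at most the original gap, which is zero by `hcol`.
  have hC0 : ∑ i, W i * (∑ d, entanglement (colSlice (N i.1 i.2) d) -
      cellEntanglement (N i.1 i.2)) = 0 := by
    refine le_antisymm ?_ (Finset.sum_nonneg fun i _ => hCle i)
    simp only [mul_sub, Finset.sum_sub_distrib, hD]
    linarith
  have hR0 : ∑ i, W i * (∑ c, entanglement (rowSlice (N i.1 i.2) c) -
      cellEntanglement (N i.1 i.2)) = 0 := by
    refine le_antisymm ?_ (Finset.sum_nonneg fun i _ => hRle i)
    simp only [mul_sub, Finset.sum_sub_distrib, hD]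
    linarith
  obtain ⟨⟨g, h⟩, hpos, hle⟩ := exists_le_of_weighted_sum_le (W := W)
    (f := fun i => entanglement (N i.1 i.2) - cellEntanglement (N i.1 i.2))
    (K := entanglement M - cellEntanglement M) hW hW1 (by
      simp only [mul_sub, Finset.sum_sub_distrib, hD]
      linarith)
  have hne := mul_ne_zero_iff.1 hpos.ne'
  refine ⟨g, h, fun c => (hu _ _).lt_of_ne' (Finset.prod_ne_zero_iff.1 hne.1 c (Finset.mem_univ c)),
    fun d => (hv _ _).lt_of_ne' (Finset.prod_ne_zero_iff.1 hne.2 d (Finset.mem_univ d)), ?_, ?_, hle⟩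
  · have := (Finset.sum_eq_zero_iff_of_nonneg fun i _ => hRle i).1 hR0 (g, h) (Finset.mem_univ _)
    exact sub_eq_zero.1 ((mul_eq_zero.1 this).resolve_left hpos.ne')
  · have := (Finset.sum_eq_zero_iff_of_nonneg fun i _ => hCle i).1 hC0 (g, h) (Finset.mem_univ _)
    exact sub_eq_zero.1 ((mul_eq_zero.1 this).resolve_left hpos.ne')

end SelectedState

/-! ### Dependent parts -/

section DependentPart

variable {X Y : Type*} [Fintype X] [Fintype Y] {P : X × Y → ℝ}

omit [Fintype X] in
theorem le_margFst (hP : ∀ z, 0 ≤ P z) (x : X) (y : Y) : P (x, y) ≤ margFst P x :=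
  Finset.single_le_sum (f := fun y => P (x, y)) (fun _ _ => hP _) (Finset.mem_univ y)

omit [Fintype Y] in
theorem le_margSnd (hP : ∀ z, 0 ≤ P z) (x : X) (y : Y) : P (x, y) ≤ margSnd P y :=
  Finset.single_le_sum (f := fun x => P (x, y)) (fun _ _ => hP _) (Finset.mem_univ x)

omit [Fintype X] in
theorem margFst_mul_condFst (hP : ∀ z, 0 ≤ P z) (x : X) (y : Y) :
    margFst P x * condFst P x y = P (x, y) := by
  by_cases h : margFst P x = 0
  · rw [h, zero_mul]
    exact le_antisymm (hP _) (h ▸ le_margFst hP x y)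
  · exact mul_div_cancel₀ _ h

omit [Fintype Y] in
theorem margSnd_mul_condSnd (hP : ∀ z, 0 ≤ P z) (x : X) (y : Y) :
    margSnd P y * condSnd P y x = P (x, y) := by
  by_cases h : margSnd P y = 0
  · rw [h, zero_mul]
    exact le_antisymm (hP _) (h ▸ le_margSnd hP x y)
  · exact mul_div_cancel₀ _ h

/-- The expectation of a function of the dependent parts. -/
theorem sum_depPart_mul (hP : ∀ z, 0 ≤ P z) (G : DepFst P × DepSnd P → ℝ) (φ : X → Y → ℝ)
    (h : ∀ x y, P (x, y) ≠ 0 → ∀ z : DepFst P × DepSnd P,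
      condFst P x = z.1.1 → condSnd P y = z.2.1 → φ x y = G z) :
    ∑ z, depPart P z * G z = ∑ x, ∑ y, P (x, y) * φ x y := by
  simp only [depPart, Finset.sum_mul]
  rw [Finset.sum_comm]
  refine Finset.sum_congr rfl fun x _ => ?_
  rw [Finset.sum_comm]
  refine Finset.sum_congr rfl fun y _ => ?_
  by_cases h0 : P (x, y) = 0
  · simp [h0]
  have hpos : 0 < P (x, y) := lt_of_le_of_ne (hP _) (Ne.symm h0)
  rw [Finset.sum_eq_single ((⟨condFst P x, x, hpos.trans_le (le_margFst hP x y), rfl⟩,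
    ⟨condSnd P y, y, hpos.trans_le (le_margSnd hP x y), rfl⟩) : DepFst P × DepSnd P)]
  · rw [if_pos ⟨rfl, rfl⟩, ← h x y h0 _ rfl rfl]
  · rintro ⟨⟨q, hq⟩, ⟨r, hr⟩⟩ - hne
    rw [if_neg, zero_mul]
    rintro ⟨rfl, rfl⟩
    exact hne rfl
  · simp

theorem margFst_depPart (hP : ∀ z, 0 ≤ P z) (c : DepFst P) :
    margFst (depPart P) c = ∑ x, if condFst P x = c.1 then margFst P x else 0 := by
  have := sum_depPart_mul hP (fun z => if z.1 = c then 1 else 0)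
    (fun x _ => if condFst P x = c.1 then 1 else 0) fun x y _ z hx _ => by
      simp only [hx]
      exact if_congr Subtype.ext_iff.symm rfl rfl
  rw [Fintype.sum_prod_type, Finset.sum_eq_single c (fun c' _ hc => by simp [hc]) (by simp)] at this
  simp only [if_true, mul_one, ← Finset.sum_mul] at this
  rw [margFst, this]
  exact Finset.sum_congr rfl fun x _ => by split_ifs <;> simp [margFst]

theorem margSnd_depPart (hP : ∀ z, 0 ≤ P z) (d : DepSnd P) :
    margSnd (depPart P) d = ∑ y, if condSnd P y = d.1 then margSnd P y else 0 := by
  have := sum_depPart_mul hP (fun z => if z.2 = d then 1 else 0)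
    (fun _ y => if condSnd P y = d.1 then 1 else 0) fun x y _ z _ hy => by
      simp only [hy]
      exact if_congr Subtype.ext_iff.symm rfl rfl
  rw [Fintype.sum_prod_type_right, Finset.sum_eq_single d (fun c' _ hc => by simp [hc]) (by simp),
    Finset.sum_comm] at this
  simp only [if_true, mul_one, ← Finset.sum_mul] at this
  rw [margSnd, this]
  exact Finset.sum_congr rfl fun x _ => by split_ifs <;> simp [margSnd]

omit [Fintype X] in
theorem margFst_nonneg (hP : ∀ z, 0 ≤ P z) (x : X) : 0 ≤ margFst P x :=
  Finset.sum_nonneg fun _ _ => hP _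

omit [Fintype Y] in
theorem margSnd_nonneg (hP : ∀ z, 0 ≤ P z) (y : Y) : 0 ≤ margSnd P y :=
  Finset.sum_nonneg fun _ _ => hP _

theorem margFst_depPart_pos (hP : ∀ z, 0 ≤ P z) (c : DepFst P) : 0 < margFst (depPart P) c := by
  obtain ⟨x, hx, hxc⟩ := c.2
  rw [margFst_depPart hP]
  refine Finset.sum_pos' (fun x _ => ?_) ⟨x, Finset.mem_univ x, by rwa [if_pos hxc]⟩
  split_ifs
  exacts [margFst_nonneg hP x, le_rfl]

theorem margSnd_depPart_pos (hP : ∀ z, 0 ≤ P z) (d : DepSnd P) : 0 < margSnd (depPart P) d := by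
  obtain ⟨y, hy, hyd⟩ := d.2
  rw [margSnd_depPart hP]
  refine Finset.sum_pos' (fun x _ => ?_) ⟨y, Finset.mem_univ y, by rwa [if_pos hyd]⟩
  split_ifs
  exacts [margSnd_nonneg hP x, le_rfl]

/-- On a pair of classes the conditional distributions are constant, so P(x,y) is P_X(x) times a
function of y and also P_Y(y) times a function of x. Summing over one class and then over the other
only rescales by the marginals. -/
theorem depPart_eq (hP : ∀ z, 0 ≤ P z) {x : X} {y : Y} (hx : margFst P x ≠ 0)
    (hy : margSnd P y ≠ 0) {z : DepFst P × DepSnd P} (hxz : condFst P x = z.1.1)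
    (hyz : condSnd P y = z.2.1) :
    depPart P z = P (x, y) / (margFst P x / margFst (depPart P) z.1 *
      (margSnd P y / margSnd (depPart P) z.2)) := by
  have h1 : depPart P z = ∑ y', if condSnd P y' = z.2.1 then
      margFst (depPart P) z.1 * z.1.1 y' else 0 := by
    rw [depPart, Finset.sum_comm]
    refine Finset.sum_congr rfl fun y' _ => ?_
    by_cases hy' : condSnd P y' = z.2.1
    · simp only [hy', and_true, if_true]
      rw [margFst_depPart hP, Finset.sum_mul]
      refine Finset.sum_congr rfl fun x' _ => ?_
      split_ifs with hx'
      · rw [← hx', margFst_mul_condFst hP]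
      · rw [zero_mul]
    · simp [hy']
  have h2 : depPart P z = margFst (depPart P) z.1 / margFst P x *
      (margSnd (depPart P) z.2 * z.2.1 x) := by
    rw [h1, margSnd_depPart hP, Finset.sum_mul, Finset.mul_sum]
    refine Finset.sum_congr rfl fun y' _ => ?_
    split_ifs with hy'
    -- `P (x, y')` is factored once through each marginal.
    · rw [← hy', margSnd_mul_condSnd hP, ← margFst_mul_condFst hP, ← hxz]
      field_simp
    · simp
  rw [h2, ← hyz, ← margSnd_mul_condSnd hP x y]
  have := (margFst_depPart_pos hP z.1).ne'
  have := (margSnd_depPart_pos hP z.2).ne'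
  field_simp

theorem classicalInfo_eq_sum (P : X × Y → ℝ) :
    classicalInfo P = (∑ x, ∑ y, P (x, y) *
      (Real.log (P (x, y)) - Real.log (margFst P x) - Real.log (margSnd P y))) / Real.log 2 := by
  rw [classicalInfo, shannon, shannon, shannon, ← add_div, ← sub_div]
  congr 1
  simp only [mul_sub, Finset.sum_sub_distrib]
  rw [Finset.sum_comm (f := fun x y => P (x, y) * Real.log (margSnd P y))]
  simp only [← Finset.sum_mul, Fintype.sum_prod_type, Real.negMulLog, neg_mul,
    Finset.sum_neg_distrib]
  simp only [margFst, margSnd]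
  ring

/-- The log-ratio of the joint probability to the product of the marginals is a function of the
dependent parts, so its expectation is unchanged. -/
theorem classicalInfo_depPart (hP : ∀ z, 0 ≤ P z) :
    classicalInfo (depPart P) = classicalInfo P := by
  rw [classicalInfo_eq_sum, classicalInfo_eq_sum, ← Fintype.sum_prod_type (f := fun z =>
    depPart P z * (Real.log (depPart P z) - Real.log (margFst (depPart P) z.1) -
      Real.log (margSnd (depPart P) z.2)))]
  congr 1
  refine sum_depPart_mul hP _ _ fun x y h0 z hx hy => ?_
  have hpos : 0 < P (x, y) := lt_of_le_of_ne (hP _) (Ne.symm h0)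
  have hx0 := (hpos.trans_le (le_margFst hP x y)).ne'
  have hy0 := (hpos.trans_le (le_margSnd hP x y)).ne'
  have hc := (margFst_depPart_pos hP z.1).ne'
  have hd := (margSnd_depPart_pos hP z.2).ne'
  rw [depPart_eq hP hx0 hy0 hx hy, Real.log_div h0 (by positivity),
    Real.log_mul (by positivity) (by positivity), Real.log_div hx0 hc, Real.log_div hy0 hd]
  ring

/-- The conditional distribution of `X` given its dependent part. -/
def repFst (P : X × Y → ℝ) (c : DepFst P) (x : X) : ℝ :=
  if condFst P x = c.1 then margFst P x / margFst (depPart P) c else 0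

/-- The conditional distribution of `Y` given its dependent part. -/
def repSnd (P : X × Y → ℝ) (d : DepSnd P) (y : Y) : ℝ :=
  if condSnd P y = d.1 then margSnd P y / margSnd (depPart P) d else 0

theorem repFst_nonneg (hP : ∀ z, 0 ≤ P z) (c : DepFst P) (x : X) : 0 ≤ repFst P c x := by
  rw [repFst]
  split_ifs
  exacts [div_nonneg (margFst_nonneg hP x) (margFst_depPart_pos hP c).le, le_rfl]

theorem repSnd_nonneg (hP : ∀ z, 0 ≤ P z) (d : DepSnd P) (y : Y) : 0 ≤ repSnd P d y := by
  rw [repSnd]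
  split_ifs
  exacts [div_nonneg (margSnd_nonneg hP y) (margSnd_depPart_pos hP d).le, le_rfl]

theorem sum_repFst (hP : ∀ z, 0 ≤ P z) (c : DepFst P) : ∑ x, repFst P c x = 1 := by
  refine Eq.trans ?_ (div_self (margFst_depPart_pos hP c).ne')
  refine Eq.trans ?_ (congrArg (· / margFst (depPart P) c) (margFst_depPart hP c).symm)
  rw [Finset.sum_div]
  exact Finset.sum_congr rfl fun x _ => by rw [repFst]; split_ifs <;> simp

theorem sum_repSnd (hP : ∀ z, 0 ≤ P z) (d : DepSnd P) : ∑ y, repSnd P d y = 1 := by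
  refine Eq.trans ?_ (div_self (margSnd_depPart_pos hP d).ne')
  refine Eq.trans ?_ (congrArg (· / margSnd (depPart P) d) (margSnd_depPart hP d).symm)
  rw [Finset.sum_div]
  exact Finset.sum_congr rfl fun y _ => by rw [repSnd]; split_ifs <;> simp

/-- Values of positive probability lie in a single class, as the averaging over representatives
requires. -/
theorem existsUnique_repFst_ne_zero (hP : ∀ z, 0 ≤ P z) {x : X} (hx : margFst P x ≠ 0) :
    ∃! c, repFst P c x ≠ 0 := by
  refine ⟨⟨condFst P x, x, (margFst_nonneg hP x).lt_of_ne' hx, rfl⟩, ?_, fun c hc => ?_⟩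
  · simp only [repFst, if_true]
    exact div_ne_zero hx (margFst_depPart_pos hP _).ne'
  · by_contra hne
    exact hc (if_neg fun h => hne (Subtype.ext h.symm))

theorem existsUnique_repSnd_ne_zero (hP : ∀ z, 0 ≤ P z) {y : Y} (hy : margSnd P y ≠ 0) :
    ∃! d, repSnd P d y ≠ 0 := by
  refine ⟨⟨condSnd P y, y, (margSnd_nonneg hP y).lt_of_ne' hy, rfl⟩, ?_, fun c hc => ?_⟩
  · simp only [repSnd, if_true]
    exact div_ne_zero hy (margSnd_depPart_pos hP _).ne'
  · by_contra hne
    exact hc (if_neg fun h => hne (Subtype.ext h.symm))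

theorem depPart_eq_div (hP : ∀ z, 0 ≤ P z) {c : DepFst P} {d : DepSnd P} {x : X} {y : Y}
    (hx : repFst P c x ≠ 0) (hy : repSnd P d y ≠ 0) :
    depPart P (c, d) = P (x, y) / (repFst P c x * repSnd P d y) := by
  have hxc : condFst P x = c.1 := by
    by_contra h
    exact hx (if_neg h)
  have hyd : condSnd P y = d.1 := by
    by_contra h
    exact hy (if_neg h)
  rw [repFst, if_pos hxc] at hx ⊢
  rw [repSnd, if_pos hyd] at hy ⊢
  exact depPart_eq hP (div_ne_zero_iff.1 hx).1 (div_ne_zero_iff.1 hy).1 hxc hyd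

end DependentPart

/-! ### Embeddings of the dependent part -/

section Main

universe w

variable {X Y : Type*} {A' B' : Type w} [Fintype X] [Fintype Y] [Fintype A'] [Fintype B']
  {P : X × Y → ℝ}

/-- The vector obtained from `ψ` by selecting a representative of each dependent value. -/
def selectedState (ψ : EuclideanSpace ℂ ((X × A') × (Y × B'))) (g : DepFst P → X)
    (h : DepSnd P → Y) : EuclideanSpace ℂ ((DepFst P × A') × (DepSnd P × B')) :=
  WithLp.toLp 2 fun i => selectCol (repSnd P) h (selectRow (repFst P) g (amplitudes ψ)) i.1 i.2

omit [Fintype A'] [Fintype B'] in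
theorem selectedState_apply (hP : ∀ z, 0 ≤ P z)
    (ψ : EuclideanSpace ℂ ((X × A') × (Y × B'))) (g : DepFst P → X)
    (h : DepSnd P → Y) (c : DepFst P) (a : A') (d : DepSnd P) (b : B') :
    selectedState ψ g h ((c, a), (d, b)) =
      ((Real.sqrt (repFst P c (g c) * repSnd P d (h d)))⁻¹ : ℝ) * ψ ((g c, a), (h d, b)) := by
  have h1 : selectedState ψ g h ((c, a), (d, b)) = ((Real.sqrt (repSnd P d (h d)))⁻¹ : ℝ) *
      (((Real.sqrt (repFst P c (g c)))⁻¹ : ℝ) * ψ ((g c, a), (h d, b))) := rfl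
  rw [h1, Real.sqrt_mul (repFst_nonneg hP c (g c)), mul_inv_rev, Complex.ofReal_mul, mul_assoc]

/-- Every embedding of a primitive yields, by selecting suitable representatives, an embedding of
its dependent part with no larger leakage. -/
theorem IsEmbedding.exists_selectedState (hP : P ∈ stdSimplex ℝ (X × Y))
    {ψ : EuclideanSpace ℂ ((X × A') × (Y × B'))} (hψ : IsEmbedding P ψ) :
    ∃ (g : DepFst P → X) (h : DepSnd P → Y), (∀ c, 0 < repFst P c (g c)) ∧
      (∀ d, 0 < repSnd P d (h d)) ∧ IsEmbedding (depPart P) (selectedState ψ g h) ∧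
      leakage (depPart P) (selectedState ψ g h) ≤ leakage P ψ := by
  obtain ⟨hrow, hcol⟩ := (isEmbedding_iff hψ.outcome).1 hψ
  -- Slices at values of zero probability belong to no class and must vanish.
  have hzero : ∀ x y a b, P (x, y) = 0 → ψ ((x, a), (y, b)) = 0 := by
    intro x y a b h0
    have h1 := (Finset.sum_eq_zero_iff_of_nonneg fun a _ => Finset.sum_nonneg fun b _ =>
      sq_nonneg _).1 ((hψ.outcome x y).trans h0) a (Finset.mem_univ a)
    have h2 := (Finset.sum_eq_zero_iff_of_nonneg fun b _ => sq_nonneg _).1 h1 b (Finset.mem_univ b)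
    simpa using h2
  obtain ⟨g, h, hg, hh, h1, h2, h3⟩ := exists_selection (repFst_nonneg hP.1) (sum_repFst hP.1)
    (repSnd_nonneg hP.1) (sum_repSnd hP.1) (M := amplitudes ψ)
    (fun x => by
      by_cases hx : margFst P x = 0
      · left
        ext a r
        exact hzero _ _ _ _ (le_antisymm (hx ▸ le_margFst hP.1 x r.1) (hP.1 _))
      · exact Or.inr (existsUnique_repFst_ne_zero hP.1 hx))
    (fun y => by
      by_cases hy : margSnd P y = 0
      · left
        ext l b
        exact hzero _ _ _ _ (le_antisymm (hy ▸ le_margSnd hP.1 l.1 y) (hP.1 _))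
      · exact Or.inr (existsUnique_repSnd_ne_zero hP.1 hy)) hrow hcol
  -- The outcome distribution is right for any representatives of positive probability, not just on
  -- average.
  have hout : ∀ c d, ∑ a, ∑ b, ‖selectedState ψ g h ((c, a), (d, b))‖ ^ 2 = depPart P (c, d) := by
    intro c d
    rw [depPart_eq_div hP.1 (hg c).ne' (hh d).ne', ← hψ.outcome, Finset.sum_div]
    refine Finset.sum_congr rfl fun a _ => ?_
    rw [Finset.sum_div]
    refine Finset.sum_congr rfl fun b _ => ?_
    rw [selectedState_apply hP.1, norm_mul, mul_pow, Complex.norm_real, Real.norm_eq_abs, sq_abs,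
      inv_pow, Real.sq_sqrt (mul_nonneg (hg c).le (hh d).le), div_eq_inv_mul]
  have hemb : IsEmbedding (depPart P) (selectedState ψ g h) := (isEmbedding_iff hout).2 ⟨h1, h2⟩
  refine ⟨g, h, hg, hh, hemb, ?_⟩
  rw [leakage_eq hP hψ, leakage_eq (depPart_mem_stdSimplex hP) hemb, classicalInfo_depPart hP.1]
  exact sub_le_sub_right h3 _

/-- Every slice has a one-dimensional factor, so all three sums of slice entanglements vanish. -/
theorem isEmbedding_regularEmbedding (hP : ∀ z, 0 ≤ P z) (θ : X × Y → ℝ) :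
    IsEmbedding P (regularEmbedding P θ) := by
  have hout : ∀ x y, ∑ a, ∑ b, ‖regularEmbedding P θ ((x, a), (y, b))‖ ^ 2 = P (x, y) := by
    intro x y
    simp only [regularEmbedding, Fintype.sum_unique, norm_mul, Complex.norm_real,
      Real.norm_eq_abs, sq_abs, Real.sq_sqrt (hP _), mul_comm Complex.I,
      Complex.norm_exp_ofReal_mul_I, one_mul]
  refine (isEmbedding_iff hout).2 ?_
  simp only [entanglement_of_unique, Finset.sum_const_zero, true_and]
  exact Finset.sum_eq_zero fun y _ => by rw [← entanglement_transpose, entanglement_of_unique]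

/-- The phases are those of the representatives; the reweighting turns the moduli into those of the
dependent part. -/
theorem selectedState_regularEmbedding (hP : ∀ z, 0 ≤ P z) (θ : X × Y → ℝ) {g : DepFst P → X}
    {h : DepSnd P → Y} (hg : ∀ c, 0 < repFst P c (g c)) (hh : ∀ d, 0 < repSnd P d (h d)) :
    selectedState (regularEmbedding P θ) g h =
      regularEmbedding (depPart P) fun z => θ (g z.1, h z.2) := by
  ext ⟨⟨c, a⟩, ⟨d, b⟩⟩
  rw [selectedState_apply hP]
  simp only [regularEmbedding]
  rw [depPart_eq_div hP (hg c).ne' (hh d).ne', Real.sqrt_div (hP _), div_eq_inv_mul,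
    Complex.ofReal_mul]
  ring

end Main

end QLeak
end

theorem mainTheorem7 {X : Type*} {Y : Type*} [Fintype X] [Fintype Y]
    (P : X × Y → ℝ) (hP : P ∈ stdSimplex ℝ (X × Y)) :
    QLeak.primitiveLeakage P ≥ QLeak.primitiveLeakage (QLeak.depPart P) ∧
      QLeak.regularLeakage P ≥ QLeak.regularLeakage (QLeak.depPart P) := by
  constructor
  · refine le_iInf fun a => le_iInf fun b => le_iInf fun ψ => le_iInf fun hψ => ?_
    obtain ⟨g, h, -, -, hemb, hle⟩ := hψ.exists_selectedState hP
    -- Selection leaves the working registers untouched, so the same dimensions `a` and `b` serve.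
    exact iInf_le_of_le a <| iInf_le_of_le b <| iInf_le_of_le (QLeak.selectedState ψ g h) <|
      iInf_le_of_le hemb (EReal.coe_le_coe_iff.2 hle)
  · refine le_iInf fun θ => ?_
    obtain ⟨g, h, hg, hh, -, hle⟩ :=
      (QLeak.isEmbedding_regularEmbedding hP.1 θ).exists_selectedState hP
    rw [QLeak.selectedState_regularEmbedding hP.1 θ hg hh] at hle
    exact iInf_le_of_le _ (EReal.coe_le_coe_iff.2 hle)
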